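/- Let $\Gamma$ be a finite graph, i.e. a finite simplicial complex of dimension at most one (equivalently, a finite simple graph together with its geometric realization). Let $V(\Gamma)$ be its set of vertices and, for $v\in V(\Gamma)$, let $\mu(v)$ be the number of edges incident to $v$. Let $F(\Gamma,2)=\{(x,y)\in\Gamma\times\Gamma : x\neq y\}$, with the subspace topology, be the configuration space of two distinct points of $\Gamma$. For a topological space $X$ whose integral singular homology groups $H_n(X;\mathbf Z)$ are finitely generated and vanish for all but finitely many $n$, write $\chi(X)=\sum_{n\ge 0}(-1)^n\operatorname{rank}H_n(X;\mathbf Z)$ for its Euler characteristic. Then $\Gamma$ and $F(\Gamma,2)$ satisfy this finiteness condition, and $$\chi(F(\Gamma,2))=\chi(\Gamma)^2+\chi(\Gamma)-\sum_{v\in V(\Gamma)}(\mu(v)-1)(\mu(v)-2).$$ -/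

import Mathlib

universe u

namespace GraphConfig

/-- The integral singular homology group `H_n(X; ℤ)`. The coefficient module is `ℤ`, lifted to the
universe of `X`. -/
noncomputable def homologyGroup (n : ℕ) (X : Type u) [TopologicalSpace X] : ModuleCat.{u} ℤ :=
  ((AlgebraicTopology.singularHomologyFunctor (ModuleCat.{u} ℤ) n).obj
    (ModuleCat.of ℤ (ULift.{u} ℤ))).obj (TopCat.of X)

/-- The total homology of `X` is finitely generated: every `H_n(X; ℤ)` is finitely generated and
all but finitely many of them vanish. This is what makes the Euler characteristic meaningful. -/
def HasFiniteHomology (X : Type u) [TopologicalSpace X] : Prop :=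
  (∀ n, Module.Finite ℤ (homologyGroup n X)) ∧ ∃ N, ∀ n, N ≤ n → Subsingleton (homologyGroup n X)

/-- The Euler characteristic `χ(X) = ∑ₙ (-1)ⁿ rank H_n(X; ℤ)`, for a space with finitely generated
total homology. -/
noncomputable def eulerChar (X : Type u) [TopologicalSpace X] : ℤ :=
  ∑ᶠ n : ℕ, (-1 : ℤ) ^ n * (Module.finrank ℤ (homologyGroup n X) : ℤ)

/-- The geometric realization of the one-dimensional simplicial complex given by a finite simple
graph, in barycentric coordinates: the points of the standard simplex on the vertex set whose
support is contained in a single vertex or in the two ends of an edge. It is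
used with the subspace topology. -/
def realization {V : Type u} [Fintype V] (G : SimpleGraph V) : Set (V → ℝ) :=
  {x | x ∈ stdSimplex ℝ V ∧
    ((∃ v, ∀ w, x w ≠ 0 → w = v) ∨ ∃ a b, G.Adj a b ∧ ∀ w, x w ≠ 0 → w = a ∨ w = b)}

/-- The configuration space `F(X, 2) = X × X - Δ` of ordered pairs of distinct points of `X`. -/
abbrev ConfigTwo (X : Type u) : Type u := {p : X × X // p.1 ≠ p.2}

end GraphConfig

/-! The space of pairs is not compact, so rather than giving it a cell structure the proof
stratifies it. Let `s` map a space to a finite poset so that every open star `{x | p ≤ s x}` is open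
and contractible. Removing minimal elements one at a time, Mayer–Vietoris gives χ as the sum of the
local contributions `c p = χ{x | p ≤ s x} - χ{x | p < s x}`. A double count then shows that χ is the
sum of any weights `k` with total 1 below every value of `s` (`eulerChar_of_stratification`).

For Γ, `s x` is the support of the barycentric coordinates. For pairs, `s (x, y)` consists of the
face where `x` has the larger coordinates and the face where `y` does; these are disjoint. In both
cases the stars are star-shaped about barycenters of faces, and the weights are products of signs
`(-1) ^ dim`. Hence χ(F(Γ,2)) is the signed count of ordered pairs of disjoint faces.

Disjointness is detected by subtracting the signed sum over the common faces `C`, which is 1 when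
the two faces meet (`sum_disjoint_faces`). This leaves χ(Γ)² minus the sum over `C` of sign(C) times
the square of the signed count of faces above `C`. That count is 1 - μ(v) at a vertex and -1 at an
edge, and the handshake lemma finishes the computation.

Mayer–Vietoris itself rests on the theorem of small simplices. Iterated barycentric subdivision,
chain homotopic to the identity, makes every singular chain subordinate to an open cover of two sets
(`exists_sub_singBoundary_mem_smallChains`). -/

namespace GraphConfig

/-! ### Alternating sums of face maps on free abelian groups -/

section AlternatingSum

variable {A B C D : Type*}

/-- The alternating sum `∑ (-1)ⁱ Fᵢ` of a finite family of maps, extended linearly to the free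
abelian groups. -/
noncomputable def altSum {n : ℕ} (F : Fin n → A → B) : (A →₀ ℤ) →ₗ[ℤ] (B →₀ ℤ) :=
  ∑ i : Fin n, (-1 : ℤ) ^ (i : ℕ) • Finsupp.lmapDomain ℤ ℤ (F i)

lemma altSum_single {n : ℕ} (F : Fin n → A → B) (a : A) (m : ℤ) :
    altSum F (Finsupp.single a m) =
      ∑ i : Fin n, (-1 : ℤ) ^ (i : ℕ) • Finsupp.single (F i a) m := by
  simp [altSum, LinearMap.sum_apply, Finsupp.mapDomain_single]

lemma lmapDomain_altSum {n : ℕ} (F : Fin n → A → B) (F' : Fin n → C → D) (h : B → D) (k : A → C)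
    (hF : ∀ i a, h (F i a) = F' i (k a)) (c : A →₀ ℤ) :
    Finsupp.lmapDomain ℤ ℤ h (altSum F c) = altSum F' (Finsupp.lmapDomain ℤ ℤ k c) := by
  induction c using Finsupp.induction_linear with
  | zero => simp
  | add x y hx hy => simp only [map_add, hx, hy]
  | single a m =>
    simp only [altSum_single, map_sum, map_smul, Finsupp.lmapDomain_apply,
      Finsupp.mapDomain_single, hF]

lemma altSum_comm {n m : ℕ} (F : Fin n → A → B) (G : Fin m → B → D) (F' : Fin n → C → D)
    (G' : Fin m → A → C) (h : ∀ i j a, G j (F i a) = F' i (G' j a)) (c : A →₀ ℤ) :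
    altSum G (altSum F c) = altSum F' (altSum G' c) := by
  induction c using Finsupp.induction_linear with
  | zero => simp
  | add x y hx hy => simp only [map_add, hx, hy]
  | single a k =>
    simp only [altSum_single, map_sum, map_smul, Finset.smul_sum, smul_smul, h]
    rw [Finset.sum_comm]
    simp only [mul_comm]

/-- The terms cancel in pairs: the index pair `(i, j)` with `j ≤ i` is matched with `(j, i + 1)`,
which has the opposite sign and, by the cosimplicial identity, the same value. -/
lemma altSum_altSum_of_cosimplicial {n : ℕ} (F : Fin (n + 2) → A → B) (G : Fin (n + 3) → B → C)
    (h : ∀ i j : Fin (n + 2), i ≤ j → ∀ a, G j.succ (F i a) = G i.castSucc (F j a))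
    (c : A →₀ ℤ) : altSum G (altSum F c) = 0 := by
  induction c using Finsupp.induction_linear with
  | zero => simp
  | add x y hx hy => simp only [map_add, hx, hy, add_zero]
  | single a k =>
    simp only [altSum_single, map_sum, map_smul, Finset.smul_sum, smul_smul, ← Finset.sum_product']
    let S : Finset (Fin (n + 2) × Fin (n + 3)) := {ij | (ij.2 : ℕ) ≤ (ij.1 : ℕ)}
    rw [Finset.univ_product_univ, ← Finset.sum_add_sum_compl S, ← eq_neg_iff_add_eq_zero,
      ← Finset.sum_neg_distrib]
    let φ : ∀ ij : Fin (n + 2) × Fin (n + 3), ij ∈ S → Fin (n + 2) × Fin (n + 3) := fun ij hij =>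
      (Fin.castLT ij.2 (lt_of_le_of_lt (Finset.mem_filter.mp hij).right (Fin.is_lt ij.1)),
        ij.1.succ)
    apply Finset.sum_bij φ
    · intro ij hij
      simp_rw [S, φ, Finset.compl_filter, Finset.mem_filter_univ, Fin.val_succ,
        Fin.val_castLT] at hij ⊢
      lia
    · rintro ⟨i, j⟩ hij ⟨i', j'⟩ hij' h
      rw [Prod.mk_inj]
      exact ⟨by simpa [φ] using! congr_arg Prod.snd h,
        by simpa [φ, Fin.castSucc_castLT] using! congr_arg Fin.castSucc (congr_arg Prod.fst h)⟩
    · rintro ⟨i', j'⟩ hij'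
      simp_rw [S, Finset.compl_filter, Finset.mem_filter_univ, not_le] at hij'
      refine ⟨(j'.pred <| ?_, Fin.castSucc i'), ?_, ?_⟩
      · rintro rfl
        simp only [Fin.val_zero, not_lt_zero] at hij'
      · simpa [S] using! Nat.le_sub_one_of_lt hij'
      · simp only [φ, Fin.castLT_castSucc, Fin.succ_pred]
    · rintro ⟨i, j⟩ hij
      have hij' : (j : ℕ) ≤ i := by simpa [S] using hij
      have := h (Fin.castLT j (lt_of_le_of_lt hij' i.2)) i hij' a
      simp only [Fin.castSucc_castLT] at this
      simp only [φ, this, ← neg_smul, Fin.val_succ, pow_add, pow_one, Fin.val_castLT]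
      congr 1
      ring

end AlternatingSum

/-! ### Tuples of points of the standard simplices -/

/-- The standard topological `n`-simplex. -/
abbrev Simplex (n : ℕ) : Type := stdSimplex ℝ (Fin (n + 1))

/-- The affine map between standard simplices with prescribed values `w` at the vertices. -/
noncomputable def affineMap {n m : ℕ} (w : Fin (n + 1) → Simplex m) : C(Simplex n, Simplex m) where
  toFun t := ⟨fun k => ∑ i, t i * w i k,
    fun k => Finset.sum_nonneg fun i _ => mul_nonneg (t.2.1 i) ((w i).2.1 k), by
      rw [Finset.sum_comm]
      simp only [← Finset.mul_sum, stdSimplex.sum_eq_one, mul_one]⟩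
  continuous_toFun := by
    refine Continuous.subtype_mk (continuous_pi fun k => continuous_finsetSum _ fun i _ => ?_) _
    exact ((continuous_apply i).comp continuous_subtype_val).mul continuous_const

lemma affineMap_apply {n m : ℕ} (w : Fin (n + 1) → Simplex m) (t : Simplex n) (k : Fin (m + 1)) :
    affineMap w t k = ∑ i, t i * w i k := rfl

lemma affineMap_affineMap {n m l : ℕ} (v : Fin (m + 1) → Simplex l) (w : Fin (n + 1) → Simplex m)
    (t : Simplex n) : affineMap v (affineMap w t) = affineMap (fun i => affineMap v (w i)) t := by
  ext k
  simp only [affineMap_apply, Finset.sum_mul, Finset.mul_sum]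
  rw [Finset.sum_comm]
  simp only [mul_assoc]

/-- The tuple of the vertices of the standard simplex. -/
noncomputable def vertices (n : ℕ) : Fin (n + 1) → Simplex n := fun i => stdSimplex.vertex i

lemma affineMap_vertices_apply {n : ℕ} (t : Simplex n) : affineMap (vertices n) t = t := by
  ext k
  simp [affineMap_apply, vertices, Pi.single_apply]

lemma affineMap_vertex {n m : ℕ} (w : Fin (n + 1) → Simplex m) (i : Fin (n + 1)) :
    affineMap w (vertices n i) = w i := by
  ext k
  simp [affineMap_apply, vertices, Pi.single_apply]

lemma affineMap_vertices_comp_apply {n m : ℕ} (f : Fin (n + 1) → Fin (m + 1)) (t : Simplex n) :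
    affineMap (vertices m ∘ f) t = stdSimplex.map f t := by
  ext k
  simp [affineMap_apply, vertices, FunOnFinite.linearMap_apply_apply, Pi.single_apply,
    Finset.sum_filter, eq_comm]

/-- The inclusion of the `i`-th face of the standard simplex. -/
noncomputable def faceMap {n : ℕ} (i : Fin (n + 2)) : C(Simplex n, Simplex (n + 1)) :=
  affineMap (vertices (n + 1) ∘ i.succAbove)

lemma faceMap_apply_succAbove {n : ℕ} (i : Fin (n + 2)) (t : Simplex n) (k : Fin (n + 1)) :
    faceMap i t (i.succAbove k) = t k := by
  simp [faceMap, affineMap_apply, vertices, Pi.single_apply]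

lemma affineMap_faceMap {n m : ℕ} (w : Fin (n + 2) → Simplex m) (i : Fin (n + 2)) (t : Simplex n) :
    affineMap w (faceMap i t) = affineMap (w ∘ i.succAbove) t := by
  rw [faceMap, affineMap_affineMap]
  simp only [Function.comp_def, affineMap_vertex]

lemma faceMap_faceMap {n : ℕ} (i j : Fin (n + 2)) (hij : i ≤ j) (t : Simplex n) :
    faceMap j.succ (faceMap i t) = faceMap i.castSucc (faceMap j t) := by
  have h := CategoryTheory.CosimplicialObject.δ_comp_δ
    (CategoryTheory.Functor.id SimplexCategory) hij
  rw [faceMap, affineMap_faceMap, faceMap, affineMap_faceMap]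
  congr 2
  funext k
  have := congrArg (fun f => f.toOrderHom k) h
  exact congrArg (vertices (n + 2)) this

/-! ### The barycentric subdivision of the standard simplex -/

/-- Integral chains of `(r + 1)`-tuples of points of the standard `n`-simplex. -/
abbrev TupleChain (r n : ℕ) : Type := (Fin (r + 1) → Simplex n) →₀ ℤ

/-- The boundary of a chain of tuples. -/
noncomputable def tupleBoundary (r n : ℕ) : TupleChain (r + 1) n →ₗ[ℤ] TupleChain r n :=
  altSum fun i w => w ∘ i.succAbove

/-- The alternating sum of the images of a chain of tuples under the face inclusions. -/
noncomputable def faceSum (r n : ℕ) : TupleChain r n →ₗ[ℤ] TupleChain r (n + 1) :=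
  altSum fun i w k => faceMap i (w k)

lemma tupleBoundary_faceSum {r n : ℕ} (c : TupleChain (r + 1) n) :
    tupleBoundary r (n + 1) (faceSum (r + 1) n c) = faceSum r n (tupleBoundary r n c) := by
  rw [tupleBoundary, faceSum, faceSum, tupleBoundary]
  apply altSum_comm
  intro i j w
  rfl

lemma faceSum_faceSum {r n : ℕ} (c : TupleChain r n) : faceSum r (n + 1) (faceSum r n c) = 0 :=
  altSum_altSum_of_cosimplicial _ _
    (fun i j hij _ => funext fun _ => faceMap_faceMap i j hij _) c

/-- Prepend a point to each tuple. -/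
noncomputable def cone {n : ℕ} (b : Simplex n) (r : ℕ) :
    TupleChain r n →ₗ[ℤ] TupleChain (r + 1) n :=
  Finsupp.lmapDomain ℤ ℤ fun w => Fin.cons b w

/-- Deleting the apex returns `c`; deleting any other vertex cones a face of `c`, with the sign
shifted by one. Thus the cone on a cycle bounds it. -/
lemma tupleBoundary_cone {r n : ℕ} (b : Simplex n) (c : TupleChain (r + 1) n) :
    tupleBoundary (r + 1) n (cone b (r + 1) c) = c - cone b r (tupleBoundary r n c) := by
  induction c using Finsupp.induction_linear with
  | zero => simp
  | add x y hx hy => simp only [map_add, hx, hy]; abel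
  | single w m =>
    simp only [cone, Finsupp.lmapDomain_apply, Finsupp.mapDomain_single, tupleBoundary,
      altSum_single]
    rw [Fin.sum_univ_succ, ← Finsupp.lmapDomain_apply ℤ ℤ, map_sum, sub_eq_add_neg,
      ← Finset.sum_neg_distrib]
    congr 1
    · simp only [Fin.val_zero, pow_zero, one_smul]
      congr 1
    · refine Finset.sum_congr rfl fun i _ => ?_
      rw [map_smul, Finsupp.lmapDomain_apply, Finsupp.mapDomain_single, Fin.val_succ, pow_succ,
        mul_neg_one, neg_smul]
      congr 3
      funext k
      refine Fin.cases ?_ (fun k => ?_) k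
      · simp
      · simp

/-- In the lowest degree the far end of each coned edge is the apex, which produces the augmentation
of `c` as a correction term. -/
lemma tupleBoundary_cone_zero {n : ℕ} (b : Simplex n) (c : TupleChain 0 n) :
    tupleBoundary 0 n (cone b 0 c) = c - (c.sum fun _ m => m) • Finsupp.single (fun _ => b) 1 := by
  induction c using Finsupp.induction_linear with
  | zero => simp
  | add x y hx hy =>
    simp only [map_add, hx, hy]
    rw [Finsupp.sum_add_index' (fun _ => rfl) (fun _ _ _ => rfl), add_smul]
    abel
  | single w m =>
    have h0 : (Fin.cons b w : Fin 2 → Simplex n) ∘ Fin.succAbove 0 = w := by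
      funext k; simp
    have h1 : (Fin.cons b w : Fin 2 → Simplex n) ∘ Fin.succAbove 1 = fun _ => b := by
      funext k; rw [Subsingleton.elim k 0]; rfl
    simp only [cone, Finsupp.lmapDomain_apply, Finsupp.mapDomain_single, tupleBoundary,
      altSum_single]
    rw [Fin.sum_univ_two]
    erw [h0, h1]
    simp [sub_eq_add_neg]

/-- The barycentric subdivision of the standard simplex. -/
noncomputable def subdivChain : (n : ℕ) → TupleChain n n
  | 0 => Finsupp.single (vertices 0) 1
  | n + 1 => cone stdSimplex.barycenter n (faceSum n n (subdivChain n))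

/-- A chain interpolating between the standard simplex and its barycentric subdivision. -/
noncomputable def homotopyChain : (n : ℕ) → TupleChain (n + 1) n
  | 0 => 0
  | n + 1 => cone stdSimplex.barycenter (n + 1)
      (Finsupp.single (vertices (n + 1)) 1 - subdivChain (n + 1) -
        faceSum (n + 1) n (homotopyChain n))

lemma tupleBoundary_vertices (n : ℕ) :
    tupleBoundary n (n + 1) (Finsupp.single (vertices (n + 1)) 1) =
      faceSum n n (Finsupp.single (vertices n) 1) := by
  simp only [tupleBoundary, faceSum, altSum_single]
  refine Finset.sum_congr rfl fun i _ => ?_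
  congr 2
  funext k
  simp only [faceMap, affineMap_vertex]

lemma tupleBoundary_subdivChain (n : ℕ) :
    tupleBoundary n (n + 1) (subdivChain (n + 1)) = faceSum n n (subdivChain n) := by
  cases n with
  | zero =>
    -- The two endpoints of the 1-simplex enter with opposite signs, so the augmentation term
    -- vanishes.
    refine (tupleBoundary_cone_zero _ _).trans ?_
    simp only [subdivChain, faceSum, altSum_single, Fin.sum_univ_succ]
    simp [Finsupp.sum_add_index', Finsupp.sum_neg_index]
  | succ n =>
    rw [subdivChain, tupleBoundary_cone, tupleBoundary_faceSum, tupleBoundary_subdivChain n,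
      faceSum_faceSum, map_zero, sub_zero]

/-- This is the universal case of the homotopy formula `∂T + T∂ = 1 - Sd`. The chain coned off to
define `T` is a cycle, by the formula one dimension lower and `faceSum_faceSum`, so the boundary of
the cone gives it back. -/
lemma tupleBoundary_homotopyChain (n : ℕ) :
    tupleBoundary (n + 1) (n + 1) (homotopyChain (n + 1)) + faceSum (n + 1) n (homotopyChain n) =
      Finsupp.single (vertices (n + 1)) 1 - subdivChain (n + 1) := by
  have key : tupleBoundary n (n + 1) (Finsupp.single (vertices (n + 1)) 1 - subdivChain (n + 1)
      - faceSum (n + 1) n (homotopyChain n)) = 0 := by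
    rw [map_sub, map_sub, tupleBoundary_vertices, tupleBoundary_subdivChain, tupleBoundary_faceSum]
    cases n with
    | zero => simp [homotopyChain, subdivChain]
    | succ n =>
      rw [← map_sub, ← map_sub, ← tupleBoundary_homotopyChain n, add_sub_cancel_left,
        faceSum_faceSum]
  rw [homotopyChain, tupleBoundary_cone, key, map_zero]
  abel

/-- In every simplex of the barycentric subdivision, any two vertices share a barycentric
coordinate at which both are positive. -/
lemma exists_pos_of_mem_support_subdivChain (n : ℕ) :
    ∀ w ∈ (subdivChain n).support, ∀ i j, ∃ k, 0 < w i k ∧ 0 < w j k := by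
  have aux : ∀ {n : ℕ} (t : Simplex n), ∃ k, 0 < t k := fun t => by
    by_contra! h
    have := Finset.sum_nonpos (s := Finset.univ) fun i _ => h i
    rw [stdSimplex.sum_eq_one] at this
    linarith
  have hb : ∀ {n : ℕ} (k : Fin (n + 1)), 0 < (stdSimplex.barycenter : Simplex n) k := fun k => by
    change (0 : ℝ) < (Fintype.card _ : ℝ)⁻¹
    positivity
  induction n with
  | zero =>
    intro w hw i j
    rw [Subsingleton.elim (α := Fin 1) i j]
    obtain ⟨k, hk⟩ := aux (w j)
    exact ⟨k, hk, hk⟩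
  | succ n ih =>
    classical
    intro w hw
    obtain ⟨w', hw', rfl⟩ := Finset.mem_image.1 (Finsupp.mapDomain_support hw)
    have : ∃ (a : Fin (n + 2)) (v : Fin (n + 1) → Simplex n), v ∈ (subdivChain n).support ∧
        w' = fun k => faceMap a (v k) := by
      simp only [faceSum, altSum, LinearMap.sum_apply, LinearMap.smul_apply] at hw'
      obtain ⟨a, -, ha⟩ := Finset.mem_biUnion.1 (Finsupp.support_finsetSum hw')
      obtain ⟨v, hv, rfl⟩ := Finset.mem_image.1
        (Finsupp.mapDomain_support (Finsupp.support_smul ha))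
      exact ⟨a, v, hv, rfl⟩
    obtain ⟨a, v, hv, rfl⟩ := this
    intro i j
    -- All coordinates of the barycenter are positive, so it shares one with any point. Two other
    -- vertices lie on the same face `a`, where the induction hypothesis applies.
    refine Fin.cases ?_ (fun i => ?_) i
    · obtain ⟨k, hk⟩ := aux ((Fin.cons stdSimplex.barycenter fun k => faceMap a (v k) :
        Fin (n + 2) → Simplex (n + 1)) j)
      exact ⟨k, hb k, hk⟩
    · refine Fin.cases ?_ (fun j => ?_) j
      · obtain ⟨k, hk⟩ := aux (faceMap a (v i))
        exact ⟨k, hk, hb k⟩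
      · obtain ⟨k, hk⟩ := ih v hv i j
        refine ⟨a.succAbove k, ?_⟩
        simpa only [Fin.cons_succ, faceMap_apply_succAbove] using hk

end GraphConfig

namespace GraphConfig

/-! ### Subdivision of singular chains -/

section Subdivision

variable {X : Type u} [TopologicalSpace X]

/-- Integral singular `n`-chains of `X`. -/
abbrev SingChain (n : ℕ) (X : Type u) [TopologicalSpace X] : Type u := C(Simplex n, X) →₀ ℤ

/-- The boundary of a singular chain. -/
noncomputable def singBoundary (n : ℕ) : SingChain (n + 1) X →ₗ[ℤ] SingChain n X :=
  altSum fun i σ => σ.comp (faceMap i)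

/-- The image of a chain of tuples under a singular simplex. -/
noncomputable def pushTuples {n : ℕ} (σ : C(Simplex n, X)) (r : ℕ) :
    TupleChain r n →ₗ[ℤ] SingChain r X :=
  Finsupp.lmapDomain ℤ ℤ fun w => σ.comp (affineMap w)

lemma singBoundary_pushTuples {n r : ℕ} (σ : C(Simplex n, X)) (c : TupleChain (r + 1) n) :
    singBoundary r (pushTuples σ (r + 1) c) = pushTuples σ r (tupleBoundary r n c) := by
  rw [singBoundary, pushTuples, pushTuples, tupleBoundary]
  symm
  apply lmapDomain_altSum
  intro i w
  ext t
  exact congrArg σ (affineMap_faceMap w i t).symm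

lemma pushTuples_faceSum {n r : ℕ} (σ : C(Simplex (n + 1), X)) (c : TupleChain r n) :
    pushTuples σ r (faceSum r n c) =
      ∑ i : Fin (n + 2), (-1 : ℤ) ^ (i : ℕ) • pushTuples (σ.comp (faceMap i)) r c := by
  simp only [faceSum, altSum, LinearMap.sum_apply, LinearMap.smul_apply, map_sum, map_smul,
    pushTuples, Finsupp.lmapDomain_apply, ← Finsupp.mapDomain_comp]
  refine Finset.sum_congr rfl fun i _ => ?_
  congr 2
  funext w
  ext t
  exact congrArg σ (affineMap_affineMap _ w t).symm

lemma pushTuples_vertices {n : ℕ} (σ : C(Simplex n, X)) (m : ℤ) :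
    pushTuples σ n (Finsupp.single (vertices n) m) = Finsupp.single σ m := by
  rw [pushTuples, Finsupp.lmapDomain_apply, Finsupp.mapDomain_single]
  congr 1
  ext t
  exact congrArg σ (affineMap_vertices_apply t)

/-- The barycentric subdivision of singular chains. -/
noncomputable def subdiv (n : ℕ) : SingChain n X →ₗ[ℤ] SingChain n X :=
  Finsupp.linearCombination ℤ fun σ => pushTuples σ n (subdivChain n)

/-- A chain homotopy between the identity and the barycentric subdivision. -/
noncomputable def subdivHomotopy (n : ℕ) : SingChain n X →ₗ[ℤ] SingChain (n + 1) X :=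
  Finsupp.linearCombination ℤ fun σ => pushTuples σ (n + 1) (homotopyChain n)

lemma singBoundary_singBoundary (n : ℕ) (z : SingChain (n + 2) X) :
    singBoundary n (singBoundary (n + 1) z) = 0 := by
  induction z using Finsupp.induction_linear with
  | zero => simp
  | add x y hx hy => simp only [map_add, hx, hy, add_zero]
  | single σ m =>
    rw [← pushTuples_vertices, singBoundary_pushTuples, singBoundary_pushTuples,
      ← mul_one m, ← smul_eq_mul, ← Finsupp.smul_single, map_smul, tupleBoundary_vertices, map_smul,
      tupleBoundary_faceSum, tupleBoundary_vertices, faceSum_faceSum, smul_zero, map_zero]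

lemma singBoundary_subdivHomotopy (n : ℕ) (z : SingChain (n + 1) X) :
    singBoundary (n + 1) (subdivHomotopy (n + 1) z) + subdivHomotopy n (singBoundary n z) =
      z - subdiv (n + 1) z := by
  induction z using Finsupp.induction_linear with
  | zero => simp
  | add x y hx hy =>
    simp only [map_add]
    rw [add_add_add_comm, hx, hy]
    abel
  | single σ m =>
    have h1 : subdivHomotopy n (singBoundary n (Finsupp.single σ m)) =
        m • pushTuples σ (n + 1) (faceSum (n + 1) n (homotopyChain n)) := by
      simp only [singBoundary, altSum_single, map_sum, map_smul, subdivHomotopy,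
        Finsupp.linearCombination_single, pushTuples_faceSum, Finset.smul_sum]
      exact Finset.sum_congr rfl fun i _ => smul_comm _ _ _
    rw [h1]
    simp only [subdivHomotopy, subdiv, Finsupp.linearCombination_single, map_smul,
      singBoundary_pushTuples]
    rw [← smul_add, ← map_add, tupleBoundary_homotopyChain, map_sub, pushTuples_vertices,
      smul_sub, Finsupp.smul_single, smul_eq_mul, mul_one]

/-! ### Iterated subdivisions are fine -/

/-- Two averages that both put weight at least `ε` on `a k` agree on that share, so only the
remaining weight `1 - ε` can contribute to their difference. -/
lemma sum_mul_sub_sum_mul_le {n : ℕ} (x y : Simplex n) (a : Fin (n + 1) → ℝ) {D ε : ℝ}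
    (ha : ∀ i j, a i - a j ≤ D) (k : Fin (n + 1)) (hx : ε ≤ x k) (hy : ε ≤ y k) :
    ∑ i, x i * a i - ∑ i, y i * a i ≤ (1 - ε) * D := by
  obtain ⟨m, hm⟩ := Finite.exists_min a
  have e : ∀ t : Simplex n, ∑ i, t i * a i = ∑ i, t i * (a i - a m) + a m := fun t => by
    simp only [mul_sub, Finset.sum_sub_distrib, ← Finset.sum_mul, stdSimplex.sum_eq_one]
    ring
  have hy' : ε * (a k - a m) ≤ ∑ i, y i * (a i - a m) :=
    (mul_le_mul_of_nonneg_right hy (sub_nonneg.2 (hm k))).trans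
      (Finset.single_le_sum (f := fun i => y i * (a i - a m))
        (fun i _ => mul_nonneg (y.2.1 i) (sub_nonneg.2 (hm i))) (Finset.mem_univ k))
  have hx' : ∑ i, x i * (a i - a m) ≤ (1 - ε) * D + ε * (a k - a m) := by
    have h1 : ∑ i, x i * (D - (a i - a m)) = D - ∑ i, x i * (a i - a m) := by
      simp only [mul_sub, Finset.sum_sub_distrib, ← Finset.sum_mul, stdSimplex.sum_eq_one]
      ring
    have h2 : ε * (D - (a k - a m)) ≤ ∑ i, x i * (D - (a i - a m)) :=
      (mul_le_mul_of_nonneg_right hx (sub_nonneg.2 (ha k m))).trans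
        (Finset.single_le_sum (f := fun i => x i * (D - (a i - a m)))
          (fun i _ => mul_nonneg (x.2.1 i) (sub_nonneg.2 (ha i m))) (Finset.mem_univ k))
    linarith
  rw [e, e]
  linarith

/-- Tuples of points of a simplex whose pairwise sup-distances are at most `D`. -/
def fineTuples (n : ℕ) (D : ℝ) : Set (Fin (n + 1) → Simplex n) :=
  {w | ∀ i j k, w i k - w j k ≤ D}

/-- Any two vertices of a subdivision simplex share a positive coordinate. There are finitely many
such pairs, so one `ε > 0` bounds all the shared coordinates below, and `ρ = 1 - ε` works. -/
lemma exists_contraction (n : ℕ) : ∃ ρ : ℝ, 0 ≤ ρ ∧ ρ < 1 ∧ ∀ D, ∀ v ∈ fineTuples n D,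
    ∀ w ∈ (subdivChain n).support, (fun i => affineMap v (w i)) ∈ fineTuples n (ρ * D) := by
  have h : ∀ p : (subdivChain n).support × Fin (n + 1) × Fin (n + 1),
      ∃ k, 0 < p.1.1 p.2.1 k ∧ 0 < p.1.1 p.2.2 k :=
    fun p => exists_pos_of_mem_support_subdivChain n p.1.1 p.1.2 _ _
  choose k hk using h
  have h' : ∀ᶠ ε : ℝ in nhdsWithin 0 (Set.Ioi 0), 
      ∀ p : (subdivChain n).support × Fin (n + 1) × Fin (n + 1),
        ε ≤ min (p.1.1 p.2.1 (k p)) (p.1.1 p.2.2 (k p)) :=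
    Filter.eventually_all.2 fun p => by
      filter_upwards [Ioc_mem_nhdsGT (lt_min (hk p).1 (hk p).2)] with ε hε using hε.2
  obtain ⟨ε, hε, h0, h1⟩ := (h'.and (Ioc_mem_nhdsGT one_pos)).exists
  refine ⟨1 - ε, sub_nonneg.2 h1, by linarith, fun D v hv w hw i j c => ?_⟩
  have := hε (⟨w, hw⟩, i, j)
  exact sum_mul_sub_sum_mul_le (w i) (w j) (fun l => v l c) (fun a b => hv a b c) _
    (this.trans (min_le_left _ _)) (this.trans (min_le_right _ _))

lemma map_mem_of_mem_supported {A M : Type*} [AddCommGroup M] (f : (A →₀ ℤ) →ₗ[ℤ] M) (S : Set A)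
    (P : Submodule ℤ M) (h : ∀ a ∈ S, f (Finsupp.single a 1) ∈ P) {z : A →₀ ℤ}
    (hz : z ∈ Finsupp.supported ℤ ℤ S) : f z ∈ P := by
  rw [Finsupp.supported_eq_span_single] at hz
  refine (Submodule.span_le (p := P.comap f)).2 ?_ hz
  rintro _ ⟨a, ha, rfl⟩
  exact h a ha

lemma mapDomain_mem_supported {A B : Type*} (f : A → B) (S : Set B) (c : A →₀ ℤ)
    (h : ∀ a ∈ c.support, f a ∈ S) : c.mapDomain f ∈ Finsupp.supported ℤ ℤ S := by
  classical
  intro b hb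
  obtain ⟨a, ha, rfl⟩ := Finset.mem_image.1 (Finsupp.mapDomain_support hb)
  exact h a ha

/-- Subdividing `σ ∘ affineMap v` only changes the affine factor, so fineness is measured in the
standard simplex and `ρ` does not depend on `σ`. -/
lemma exists_subdiv_pow_mem_supported (n : ℕ) : ∃ ρ : ℝ, 0 ≤ ρ ∧ ρ < 1 ∧
    ∀ (σ : C(Simplex n, X)) (k : ℕ), (subdiv n ^ k) (Finsupp.single σ 1) ∈
      Finsupp.supported ℤ ℤ ((fun v => σ.comp (affineMap v)) '' fineTuples n (ρ ^ k)) := by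
  obtain ⟨ρ, h0, h1, h⟩ := exists_contraction n
  refine ⟨ρ, h0, h1, fun σ k => ?_⟩
  induction k with
  | zero =>
    refine Finsupp.single_mem_supported _ _ ⟨vertices n, fun i j l => ?_, ?_⟩
    · have := stdSimplex.le_one (vertices n i) l
      have := stdSimplex.zero_le (vertices n j) l
      rw [pow_zero]
      linarith
    · ext t
      exact congrArg σ (affineMap_vertices_apply t)
  | succ k ih =>
    rw [pow_succ' (subdiv n), Module.End.mul_apply]
    refine map_mem_of_mem_supported _ _ _ ?_ ih
    rintro _ ⟨v, hv, rfl⟩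
    rw [subdiv, Finsupp.linearCombination_single, one_smul]
    refine mapDomain_mem_supported _ _ _ fun w hw =>
      ⟨fun i => affineMap v (w i), ?_, ?_⟩
    · rw [pow_succ']
      exact h _ v hv w hw
    · ext t
      exact congrArg σ (affineMap_affineMap v w t).symm

/-! ### Small chains -/

/-- The singular simplices with image in one of two given subsets. -/
def smallSimplices (U V : Set X) (n : ℕ) : Set C(Simplex n, X) :=
  {σ | (∀ t, σ t ∈ U) ∨ ∀ t, σ t ∈ V}

/-- The chains of singular simplices with image in one of two given subsets. -/
abbrev smallChains (U V : Set X) (n : ℕ) : Submodule ℤ (SingChain n X) :=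
  Finsupp.supported ℤ ℤ (smallSimplices U V n)

lemma comp_mem_smallSimplices {U V : Set X} {n m : ℕ} {σ : C(Simplex n, X)}
    (hσ : σ ∈ smallSimplices U V n) (f : C(Simplex m, Simplex n)) :
    σ.comp f ∈ smallSimplices U V m :=
  hσ.imp (fun h t => h (f t)) fun h t => h (f t)

lemma subdivHomotopy_mem_smallChains {U V : Set X} {n : ℕ} {z : SingChain n X}
    (hz : z ∈ smallChains U V n) : subdivHomotopy n z ∈ smallChains U V (n + 1) := by
  refine map_mem_of_mem_supported _ _ _ (fun σ hσ => ?_) hz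
  rw [subdivHomotopy, Finsupp.linearCombination_single, one_smul]
  exact mapDomain_mem_supported _ _ _ fun w _ => comp_mem_smallSimplices hσ _

lemma singBoundary_mem_smallChains {U V : Set X} {n : ℕ} {z : SingChain (n + 1) X}
    (hz : z ∈ smallChains U V (n + 1)) : singBoundary n z ∈ smallChains U V n := by
  refine map_mem_of_mem_supported _ _ _ (fun σ hσ => ?_) hz
  rw [singBoundary, altSum_single]
  exact Submodule.sum_mem _ fun i _ => Submodule.smul_mem _ _
    (Finsupp.single_mem_supported _ _ (comp_mem_smallSimplices hσ _))

/-- The Lebesgue number of the cover pulled back to the compact simplex exceeds `ρ ^ k` for large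
`k`. Asking for all `k ≥ K` gives a sum of chains a common exponent. -/
lemma exists_subdiv_pow_mem_smallChains {U V : Set X} (hU : IsOpen U) (hV : IsOpen V)
    (hUV : ∀ x, x ∈ U ∨ x ∈ V) {n : ℕ} (z : SingChain n X) :
    ∃ K, ∀ k, K ≤ k → (subdiv n ^ k) z ∈ smallChains U V n := by
  induction z using Finsupp.induction_linear with
  | zero => exact ⟨0, fun k _ => by rw [map_zero]; exact Submodule.zero_mem _⟩
  | add x y hx hy =>
    obtain ⟨K, hK⟩ := hx
    obtain ⟨L, hL⟩ := hy
    refine ⟨max K L, fun k hk => ?_⟩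
    rw [map_add]
    exact Submodule.add_mem _ (hK k ((le_max_left _ _).trans hk))
      (hL k ((le_max_right _ _).trans hk))
  | single σ m =>
    obtain ⟨δ, hδ, hball⟩ := lebesgue_number_lemma_of_metric (isCompact_univ (X := Simplex n))
      (c := fun b : Bool => if b then σ ⁻¹' U else σ ⁻¹' V)
      (fun b => by
        cases b
        · exact hV.preimage σ.continuous
        · exact hU.preimage σ.continuous)
      (fun t _ => Set.mem_iUnion.2 ((hUV (σ t)).elim (fun h => ⟨true, h⟩) fun h => ⟨false, h⟩))
    obtain ⟨ρ, h0, h1, hρ⟩ := exists_subdiv_pow_mem_supported (X := X) n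
    obtain ⟨K, hK⟩ := exists_pow_lt_of_lt_one hδ h1
    refine ⟨K, fun k hk => ?_⟩
    have hk' : ρ ^ k < δ := (pow_le_pow_of_le_one h0 h1.le hk).trans_lt hK
    rw [← mul_one m, ← smul_eq_mul, ← Finsupp.smul_single, map_smul]
    refine Submodule.smul_mem _ _ (Finsupp.supported_mono ?_ (hρ σ k))
    rintro _ ⟨v, hv, rfl⟩
    have hd : ∀ s t, affineMap v t ∈ Metric.ball (affineMap v s) δ := fun s t => by
      rw [Metric.mem_ball, Subtype.dist_eq, dist_pi_lt_iff hδ]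
      intro c
      have key : ∀ s t : Simplex n, affineMap v s c - affineMap v t c ≤ ρ ^ k := fun s t => by
        -- With `ε = 0` the estimate is the plain bound by `D`, and the coordinate `0` is an
        -- arbitrary choice.
        have := sum_mul_sub_sum_mul_le s t (fun l => v l c) (fun a b => hv a b c) 0
          (s.2.1 0 |>.trans' le_rfl) (t.2.1 0 |>.trans' le_rfl)
        simpa [affineMap_apply] using this
      exact (abs_sub_le_iff.2 ⟨key t s, key s t⟩).trans_lt hk'
    obtain ⟨b, hb⟩ := hball (affineMap v (vertices n 0)) (Set.mem_univ _)
    cases b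
    · exact Or.inr fun t => hb (hd _ t)
    · exact Or.inl fun t => hb (hd _ t)

/-- A singular chain with small boundary is small up to a boundary. -/
theorem exists_sub_singBoundary_mem_smallChains {U V : Set X} (hU : IsOpen U) (hV : IsOpen V)
    (hUV : ∀ x, x ∈ U ∨ x ∈ V) {n : ℕ} (z : SingChain (n + 1) X)
    (hz : singBoundary n z ∈ smallChains U V n) :
    ∃ w : SingChain (n + 2) X, z - singBoundary (n + 1) w ∈ smallChains U V (n + 1) := by
  have step : ∀ k, ∃ w : SingChain (n + 2) X,
      z - (subdiv (n + 1) ^ k) z - singBoundary (n + 1) w ∈ smallChains U V (n + 1) ∧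
        singBoundary n ((subdiv (n + 1) ^ k) z) ∈ smallChains U V n := by
    intro k
    induction k with
    | zero => exact ⟨0, by simp, hz⟩
    | succ k ih =>
      obtain ⟨w, hw, hk⟩ := ih
      set y := (subdiv (n + 1) ^ k) z
      have hy := singBoundary_subdivHomotopy n y
      rw [pow_succ', Module.End.mul_apply]
      change ∃ w', z - subdiv (n + 1) y - _ ∈ _ ∧ singBoundary n (subdiv (n + 1) y) ∈ _
      -- Subdividing changes `y` by a boundary and by `T∂y`; the latter is small because `∂y` is
      -- small and `T` preserves small chains.
      have e : subdiv (n + 1) y = y - singBoundary (n + 1) (subdivHomotopy (n + 1) y) -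
          subdivHomotopy n (singBoundary n y) := by
        rw [sub_sub, hy, sub_sub_cancel]
      have hT := subdivHomotopy_mem_smallChains hk
      refine ⟨w + subdivHomotopy (n + 1) y, ?_, ?_⟩
      · rw [map_add]
        convert Submodule.add_mem _ hw hT using 1
        rw [e]
        abel
      · rw [e, map_sub, map_sub, singBoundary_singBoundary, sub_zero]
        exact Submodule.sub_mem _ hk (singBoundary_mem_smallChains hT)
  obtain ⟨K, hK⟩ := exists_subdiv_pow_mem_smallChains hU hV hUV z
  obtain ⟨w, hw, -⟩ := step K
  refine ⟨w, ?_⟩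
  have := Submodule.add_mem _ hw (hK K le_rfl)
  rwa [sub_right_comm, sub_add_cancel] at this

lemma mem_smallChains_zero {U V : Set X} (hUV : ∀ x, x ∈ U ∨ x ∈ V) (z : SingChain 0 X) :
    z ∈ smallChains U V 0 := by
  refine (Finsupp.mem_supported _ _).2 fun σ _ => ?_
  have h : ∀ t, σ t = σ (vertices 0 0) := fun t =>
    congrArg σ (Subsingleton.elim (α := stdSimplex ℝ (Fin 1)) _ _)
  exact (hUV (σ (vertices 0 0))).imp (fun hx t => (h t).symm ▸ hx) fun hx t => (h t).symm ▸ hx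

end Subdivision

end GraphConfig

namespace GraphConfig

open CategoryTheory Limits

/-! ### Euler characteristics of chain complexes -/

section Algebra

/-- The total homology of a chain complex of abelian groups is finitely generated. -/
def FiniteHomology (K : ChainComplex (ModuleCat.{u} ℤ) ℕ) : Prop :=
  (∀ n, Module.Finite ℤ (K.homology n)) ∧ ∃ N, ∀ n, N ≤ n → Subsingleton (K.homology n)

/-- The Euler characteristic of the homology of a chain complex of abelian groups. -/
noncomputable def homologyChi (K : ChainComplex (ModuleCat.{u} ℤ) ℕ) : ℤ :=
  ∑ᶠ n : ℕ, (-1 : ℤ) ^ n * (Module.finrank ℤ (K.homology n) : ℤ)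

lemma homologyChi_eq_sum {K : ChainComplex (ModuleCat.{u} ℤ) ℕ} {N : ℕ}
    (h : ∀ n, N ≤ n → Subsingleton (K.homology n)) :
    homologyChi K = ∑ n ∈ Finset.range N, (-1 : ℤ) ^ n * (Module.finrank ℤ (K.homology n) : ℤ) := by
  refine finsum_eq_sum_of_support_subset _ fun n hn => ?_
  rw [Finset.coe_range, Set.mem_Iio]
  by_contra! hN
  have := h n hN
  exact hn (by simp [Module.finrank_zero_of_subsingleton])

lemma FiniteHomology.of_isIso {K L : ChainComplex (ModuleCat.{u} ℤ) ℕ}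
    (e : ∀ n, Nonempty (K.homology n ≃ₗ[ℤ] L.homology n)) (h : FiniteHomology K) :
    FiniteHomology L ∧ homologyChi L = homologyChi K := by
  refine ⟨⟨fun n => ?_, ?_⟩, ?_⟩
  · have := h.1 n
    exact Module.Finite.equiv (e n).some
  · obtain ⟨N, hN⟩ := h.2
    exact ⟨N, fun n hn => have := hN n hn; (e n).some.symm.injective.subsingleton⟩
  · exact finsum_congr fun n => by rw [(e n).some.finrank_eq]

section LinearAlgebra

variable {R M N P : Type*} [CommRing R] [AddCommGroup M] [AddCommGroup N] [AddCommGroup P]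
  [Module R M] [Module R N] [Module R P]

lemma finite_of_exact [IsNoetherianRing R] [Module.Finite R M] [Module.Finite R P]
    (f : M →ₗ[R] N) (g : N →ₗ[R] P) (h : LinearMap.range f = LinearMap.ker g) :
    Module.Finite R N := by
  rw [Module.finite_def]
  refine Submodule.fg_of_fg_map_of_fg_inf_ker g ?_ ?_
  · exact IsNoetherian.noetherian _
  · rw [top_inf_eq, ← h, LinearMap.range_eq_map]
    exact Submodule.FG.map _ (Module.finite_def.1 inferInstance)

lemma subsingleton_of_exact [Subsingleton M] [Subsingleton P] (f : M →ₗ[R] N) (g : N →ₗ[R] P)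
    (h : LinearMap.range f = LinearMap.ker g) : Subsingleton N := by
  refine subsingleton_of_forall_eq 0 fun x => ?_
  have hx : x ∈ LinearMap.ker g := Subsingleton.elim _ _
  rw [← h] at hx
  obtain ⟨m, rfl⟩ := hx
  rw [Subsingleton.elim m 0, map_zero]

/-- The rank of the image of a linear map. -/
noncomputable def rangeRank (f : M →ₗ[R] N) : ℤ := Module.finrank R (LinearMap.range f)

lemma finrank_eq_rangeRank_add [IsDomain R] [Module.Finite R N] (f : M →ₗ[R] N) (g : N →ₗ[R] P)
    (h : LinearMap.range f = LinearMap.ker g) :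
    (Module.finrank R N : ℤ) = rangeRank g + rangeRank f := by
  rw [← (LinearMap.ker g).finrank_quotient_add_finrank, g.quotKerEquivRange.finrank_eq,
    Nat.cast_add, ← h, rangeRank, rangeRank]

lemma finrank_eq_rangeRank {f : M →ₗ[R] N} (h : LinearMap.range f = ⊤) :
    (Module.finrank R N : ℤ) = rangeRank f := by
  rw [rangeRank, h, finrank_top]

lemma rangeRank_eq_zero [Nontrivial R] [Subsingleton N] (f : M →ₗ[R] N) : rangeRank f = 0 := by
  rw [rangeRank, Module.finrank_zero_of_subsingleton, Nat.cast_zero]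

end LinearAlgebra

variable {S : ShortComplex (ChainComplex (ModuleCat.{u} ℤ) ℕ)} (hS : S.ShortExact)

include hS

lemma range_homologyMap_f (n : ℕ) :
    LinearMap.range (HomologicalComplex.homologyMap S.f n).hom =
      LinearMap.ker (HomologicalComplex.homologyMap S.g n).hom :=
  (hS.homology_exact₂ n).moduleCat_range_eq_ker

lemma range_homologyMap_g (n : ℕ) :
    LinearMap.range (HomologicalComplex.homologyMap S.g (n + 1)).hom =
      LinearMap.ker (hS.δ (n + 1) n rfl).hom :=
  (hS.homology_exact₃ (n + 1) n rfl).moduleCat_range_eq_ker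

lemma range_homology_δ (n : ℕ) :
    LinearMap.range (hS.δ (n + 1) n rfl).hom =
      LinearMap.ker (HomologicalComplex.homologyMap S.f n).hom :=
  (hS.homology_exact₁ (n + 1) n rfl).moduleCat_range_eq_ker

lemma range_homologyMap_g_zero :
    LinearMap.range (HomologicalComplex.homologyMap S.g 0).hom = ⊤ := by
  have := hS.epi_g
  have : Epi (HomologicalComplex.homologyMap S.g 0) :=
    HomologicalComplex.epi_homologyMap_of_epi_of_not_rel _ _ (by simp)
  exact LinearMap.range_eq_top.2 ((ModuleCat.epi_iff_surjective _).1 this)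

lemma FiniteHomology.mid (h₁ : FiniteHomology S.X₁) (h₃ : FiniteHomology S.X₃) :
    FiniteHomology S.X₂ := by
  refine ⟨fun n => ?_, ?_⟩
  · have := h₁.1 n
    have := h₃.1 n
    exact finite_of_exact _ _ (range_homologyMap_f hS n)
  · obtain ⟨N, hN⟩ := h₁.2
    obtain ⟨M, hM⟩ := h₃.2
    refine ⟨max N M, fun n hn => ?_⟩
    have := hN n ((le_max_left _ _).trans hn)
    have := hM n ((le_max_right _ _).trans hn)
    exact subsingleton_of_exact _ _ (range_homologyMap_f hS n)

lemma FiniteHomology.right (h₁ : FiniteHomology S.X₁) (h₂ : FiniteHomology S.X₂) :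
    FiniteHomology S.X₃ := by
  refine ⟨fun n => ?_, ?_⟩
  · have := h₂.1 n
    cases n with
    | zero => exact Module.Finite.of_surjective _ (LinearMap.range_eq_top.1 (range_homologyMap_g_zero hS))
    | succ n =>
      have := h₁.1 n
      exact finite_of_exact _ _ (range_homologyMap_g hS n)
  · obtain ⟨N, hN⟩ := h₁.2
    obtain ⟨M, hM⟩ := h₂.2
    refine ⟨max N M + 1, fun n hn => ?_⟩
    obtain ⟨n, rfl⟩ : ∃ k, n = k + 1 := ⟨n - 1, by omega⟩
    have := hN n (by omega)
    have := hM (n + 1) (by omega)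
    exact subsingleton_of_exact _ _ (range_homologyMap_g hS n)

/-- Each rank in the long exact sequence is the sum of the ranks of the adjacent maps, so the
alternating sum telescopes. -/
lemma homologyChi_shortExact (h₁ : FiniteHomology S.X₁) (h₂ : FiniteHomology S.X₂)
    (h₃ : FiniteHomology S.X₃) : homologyChi S.X₂ = homologyChi S.X₁ + homologyChi S.X₃ := by
  obtain ⟨N₁, hN₁⟩ := h₁.2
  obtain ⟨N₂, hN₂⟩ := h₂.2
  obtain ⟨N₃, hN₃⟩ := h₃.2
  have := h₁.1
  have := h₂.1
  have := h₃.1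
  let r : ℕ → ℤ := fun n => rangeRank (hS.δ (n + 1) n rfl).hom
  have e1 : ∀ n, (Module.finrank ℤ (S.X₁.homology n) : ℤ) =
      rangeRank (HomologicalComplex.homologyMap S.f n).hom + r n :=
    fun n => finrank_eq_rangeRank_add _ _ (range_homology_δ hS n)
  have e2 : ∀ n, (Module.finrank ℤ (S.X₂.homology n) : ℤ) =
      rangeRank (HomologicalComplex.homologyMap S.g n).hom +
        rangeRank (HomologicalComplex.homologyMap S.f n).hom :=
    fun n => finrank_eq_rangeRank_add _ _ (range_homologyMap_f hS n)
  have e3 : ∀ n, (Module.finrank ℤ (S.X₃.homology (n + 1)) : ℤ) = r n +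
      rangeRank (HomologicalComplex.homologyMap S.g (n + 1)).hom :=
    fun n => finrank_eq_rangeRank_add _ _ (range_homologyMap_g hS n)
  have e0 : (Module.finrank ℤ (S.X₃.homology 0) : ℤ) =
      rangeRank (HomologicalComplex.homologyMap S.g 0).hom :=
    finrank_eq_rangeRank (range_homologyMap_g_zero hS)
  -- After degree `n` only the rank of the connecting map out of degree `n + 1` survives; it is zero
  -- once the homology of `S.X₁` vanishes.
  have key : ∀ n, ∑ k ∈ Finset.range (n + 1), (-1 : ℤ) ^ k *
      ((Module.finrank ℤ (S.X₁.homology k) : ℤ) + Module.finrank ℤ (S.X₃.homology k) -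
        Module.finrank ℤ (S.X₂.homology k)) = (-1) ^ n * r n := by
    intro n
    induction n with
    | zero =>
      rw [zero_add, Finset.sum_range_one, e1, e2, e0]
      ring
    | succ n ih =>
      rw [Finset.sum_range_succ, ih, e1, e2, e3, pow_succ]
      ring
  let N := max N₁ (max N₂ N₃)
  have hr : r N = 0 := by
    have := hN₁ N (le_max_left _ _)
    exact rangeRank_eq_zero _
  rw [homologyChi_eq_sum (N := N + 1) fun n hn => hN₁ n (by omega),
    homologyChi_eq_sum (N := N + 1) fun n hn => hN₂ n (by omega),
    homologyChi_eq_sum (N := N + 1) fun n hn => hN₃ n (by omega), ← sub_eq_zero,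
    ← neg_eq_zero, neg_sub, ← Finset.sum_add_distrib, ← Finset.sum_sub_distrib]
  rw [← mul_zero ((-1 : ℤ) ^ N), ← hr, ← key]
  exact Finset.sum_congr rfl fun k _ => by ring

lemma homology_equiv_of_acyclic (h : ∀ n, S.X₃.ExactAt n) (n : ℕ) :
    Nonempty (S.X₁.homology n ≃ₗ[ℤ] S.X₂.homology n) := by
  have hz : ∀ n, Subsingleton (S.X₃.homology n) := fun n =>
    ModuleCat.subsingleton_of_isZero (h n).isZero_homology
  refine ⟨LinearEquiv.ofBijective (HomologicalComplex.homologyMap S.f n).hom ⟨?_, ?_⟩⟩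
  · rw [← LinearMap.ker_eq_bot, ← range_homology_δ hS n, LinearMap.range_eq_bot]
    have := hz (n + 1)
    ext x
    rw [Subsingleton.elim x 0, map_zero, map_zero]
  · rw [← LinearMap.range_eq_top, range_homologyMap_f hS n, LinearMap.ker_eq_top]
    have := hz n
    ext x
    exact Subsingleton.elim _ _

end Algebra

end GraphConfig

namespace GraphConfig

open CategoryTheory Limits

/-! ### Mayer–Vietoris for chain complexes -/

section MayerVietoris

lemma shortExact_cokernel {K L : ChainComplex (ModuleCat.{u} ℤ) ℕ} (f : K ⟶ L)
    (hf : ∀ n, Function.Injective (f.f n)) :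
    (ShortComplex.mk f (cokernel.π f) (cokernel.condition f)).ShortExact := by
  have : ∀ n, Mono (f.f n) := fun n => (ModuleCat.mono_iff_injective _).2 (hf n)
  have : Mono f := HomologicalComplex.mono_of_mono_f f inferInstance
  exact
    { exact := ShortComplex.exact_of_g_is_cokernel _ (cokernelIsCokernel f)
      mono_f := this
      epi_g := inferInstance }

section

variable {S : ShortComplex (ChainComplex (ModuleCat.{u} ℤ) ℕ)} (hS : S.ShortExact)

include hS

lemma surjective_g_f (n : ℕ) : Function.Surjective (S.g.f n) :=
  ((HomologicalComplex.shortExact_iff_degreewise_shortExact S).1 hS n).moduleCat_surjective_g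

lemma exists_f_f_eq {n : ℕ} (y : S.X₂.X n) (hy : S.g.f n y = 0) : ∃ x, S.f.f n x = y :=
  (ShortComplex.moduleCat_exact_iff _).1
    ((HomologicalComplex.shortExact_iff_degreewise_shortExact S).1 hS n).exact y hy

omit hS in
lemma g_f_f_f {n : ℕ} (x : S.X₁.X n) : S.g.f n (S.f.f n x) = 0 := by
  have := congrArg (fun φ => φ.f n x) S.zero
  exact this

end

lemma f_d_apply {K L : ChainComplex (ModuleCat.{u} ℤ) ℕ} (f : K ⟶ L) {i j : ℕ} (x : K.X i) :
    L.d i j (f.f i x) = f.f j (K.d i j x) :=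
  congrArg (fun φ => φ x) (f.comm i j)

/-- The Mayer–Vietoris principle for a square of chain complexes. -/
theorem finiteHomology_of_square {A K L C : ChainComplex (ModuleCat.{u} ℤ) ℕ}
    (a : A ⟶ K) (b : A ⟶ L) (h : K ⟶ C) (k : L ⟶ C) (comm : a ≫ h = b ≫ k)
    (ha : ∀ n, Function.Injective (a.f n)) (hk : ∀ n, Function.Injective (k.f n))
    (pull : ∀ n x y, h.f n x = k.f n y → ∃ t, a.f n t = x)
    (small_zero : ∀ z, ∃ x y, z = h.f 0 x + k.f 0 y)
    (small_succ : ∀ n z, (∃ x y, C.d (n + 1) n z = h.f n x + k.f n y) →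
      ∃ w x y, z = C.d (n + 2) (n + 1) w + h.f (n + 1) x + k.f (n + 1) y)
    (hA : FiniteHomology A) (hK : FiniteHomology K) (hL : FiniteHomology L) :
    FiniteHomology C ∧ homologyChi C + homologyChi A = homologyChi K + homologyChi L := by
  have s₁ := shortExact_cokernel a ha
  have s₂ := shortExact_cokernel k hk
  -- This is the excision map `K/A ⟶ C/L`. It is injective by `pull`, and its cokernel will be
  -- acyclic, so the two quotients have the same homology.
  let φ : cokernel a ⟶ cokernel k :=
    cokernel.desc a (h ≫ cokernel.π k) (by
      rw [← Category.assoc, comm, Category.assoc, cokernel.condition, comp_zero])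
  have hφ : ∀ n x, φ.f n ((cokernel.π a).f n x) = (cokernel.π k).f n (h.f n x) := fun n x => by
    have : cokernel.π a ≫ φ = h ≫ cokernel.π k := cokernel.π_desc _ _ _
    exact congrArg (fun ψ => ψ.f n x) this
  have s₃ := shortExact_cokernel φ (fun n => by
    rw [injective_iff_map_eq_zero]
    intro q hq
    obtain ⟨x, rfl⟩ := surjective_g_f s₁ n q
    dsimp only at hq ⊢
    rw [hφ] at hq
    obtain ⟨y, hy⟩ := exists_f_f_eq s₂ _ hq
    obtain ⟨t, rfl⟩ := pull n x y hy.symm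
    exact g_f_f_f (S := ShortComplex.mk a _ (cokernel.condition a)) t)
  have surj : ∀ n (q : (cokernel φ).X n), ∃ z, (cokernel.π φ).f n ((cokernel.π k).f n z) = q :=
    fun n q => by
      obtain ⟨q', rfl⟩ := surjective_g_f s₃ n q
      obtain ⟨z, rfl⟩ := surjective_g_f s₂ n q'
      exact ⟨z, rfl⟩
  -- The cokernel of `φ` is `C` modulo the sums from `K` and `L`, so the two `small` hypotheses
  -- express exactly its acyclicity.
  have ker : ∀ n z, (cokernel.π φ).f n ((cokernel.π k).f n z) = 0 →
      ∃ x y, z = h.f n x + k.f n y := fun n z hz => by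
    obtain ⟨q, hq⟩ := exists_f_f_eq s₃ _ hz
    obtain ⟨x, rfl⟩ := surjective_g_f s₁ n q
    dsimp only at hq
    rw [hφ] at hq
    obtain ⟨y, hy⟩ := exists_f_f_eq s₂ (z - h.f n x) (by
      dsimp only
      rw [map_sub, hq, sub_self])
    exact ⟨x, y, by rw [← sub_eq_iff_eq_add', ← hy]⟩
  have ker' : ∀ n x y, (cokernel.π φ).f n ((cokernel.π k).f n (h.f n x + k.f n y)) = 0 :=
    fun n x y => by
      have h1 : (cokernel.π k).f n (k.f n y) = 0 :=
        g_f_f_f (S := ShortComplex.mk k _ (cokernel.condition k)) y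
      have h2 : (cokernel.π φ).f n (φ.f n ((cokernel.π a).f n x)) = 0 :=
        g_f_f_f (S := ShortComplex.mk φ _ (cokernel.condition φ)) _
      rw [map_add, h1, add_zero, ← hφ, h2]
  have acyclic : ∀ n, (cokernel φ).ExactAt n := by
    intro n
    cases n with
    | zero =>
      rw [(cokernel φ).exactAt_iff' 1 0 0 (by simp) (by simp), ShortComplex.moduleCat_exact_iff]
      intro q _
      obtain ⟨z, rfl⟩ := surj 0 q
      obtain ⟨x, y, rfl⟩ := small_zero z
      exact ⟨0, (map_zero _).trans (ker' 0 x y).symm⟩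
    | succ n =>
      rw [(cokernel φ).exactAt_iff' (n + 2) (n + 1) n (by simp) (by simp),
        ShortComplex.moduleCat_exact_iff]
      intro q hq
      obtain ⟨z, rfl⟩ := surj (n + 1) q
      change (cokernel φ).d (n + 1) n _ = 0 at hq
      rw [f_d_apply, f_d_apply] at hq
      obtain ⟨w, x, y, hw⟩ := small_succ n z (ker n _ hq)
      refine ⟨(cokernel.π φ).f _ ((cokernel.π k).f _ w), ?_⟩
      change (cokernel φ).d (n + 2) (n + 1) _ = _
      rw [f_d_apply, f_d_apply, hw, add_assoc, map_add, map_add, ker', add_zero]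
  have f₁ := FiniteHomology.right s₁ hA hK
  obtain ⟨f₂, e₂⟩ := FiniteHomology.of_isIso (homology_equiv_of_acyclic s₃ acyclic) f₁
  have fC := FiniteHomology.mid s₂ hL f₂
  refine ⟨fC, ?_⟩
  have e₁ := homologyChi_shortExact s₁ hA hK f₁
  have e₃ := homologyChi_shortExact s₂ hL fC f₂
  dsimp only at e₁ e₂ e₃
  linarith

end MayerVietoris

end GraphConfig

namespace GraphConfig

open CategoryTheory Limits Simplicial

/-! ### Singular chains as finitely supported functions -/

section SingularComplex

/-- The integral singular chain complex. -/
noncomputable abbrev singComplex : TopCat.{u} ⥤ ChainComplex (ModuleCat.{u} ℤ) ℕ :=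
  (AlgebraicTopology.singularChainComplexFunctor (ModuleCat.{u} ℤ)).obj
    (ModuleCat.of ℤ (ULift.{u} ℤ))

variable (X : TopCat.{u})

/-- The continuous map underlying a simplex of the singular simplicial set. -/
noncomputable def simplexEquiv (n : ℕ) : (TopCat.toSSet.obj X) _⦋n⦌ ≃ C(Simplex n, X) :=
  X.toSSetObjEquiv (.op ⦋n⦌)

lemma simplexEquiv_δ {n : ℕ} (i : Fin (n + 2)) (x : (TopCat.toSSet.obj X) _⦋n + 1⦌) :
    simplexEquiv X n ((TopCat.toSSet.obj X).δ i x) = (simplexEquiv X (n + 1) x).comp (faceMap i) := by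
  ext t
  have : faceMap i t = stdSimplex.map i.succAbove t := affineMap_vertices_comp_apply _ t
  rw [ContinuousMap.comp_apply, this]
  rfl

variable {X} in
lemma simplexEquiv_map {Y : TopCat.{u}} (f : X ⟶ Y) {n : ℕ} (x : (TopCat.toSSet.obj X) _⦋n⦌) :
    simplexEquiv Y n ((TopCat.toSSet.map f).app _ x) = f.hom.comp (simplexEquiv X n x) := rfl

/-- The generator of the singular chain group corresponding to a singular simplex. -/
noncomputable def chainGen {n : ℕ} (x : (TopCat.toSSet.obj X) _⦋n⦌) : (singComplex.obj X).X n :=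
  ((TopCat.toSSet.obj X).ιChainComplex (R := ModuleCat.of ℤ (ULift.{u} ℤ)) x).hom ⟨1⟩

omit X in
lemma sum_zsmul_hom_apply {n : ℕ} {M N : ModuleCat.{u} ℤ} (m : Fin n → ℤ) (f : Fin n → (M ⟶ N))
    (x : M) : (∑ i, m i • f i).hom x = ∑ i, m i • (f i).hom x := by
  let ev : (M ⟶ N) →+ N :=
    { toFun := fun φ => φ.hom x
      map_zero' := rfl
      map_add' := fun _ _ => rfl }
  change ev (∑ i, m i • f i) = ∑ i, m i • ev (f i)
  simp only [map_sum, map_zsmul]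

lemma d_chainGen {n : ℕ} (x : (TopCat.toSSet.obj X) _⦋n + 1⦌) :
    (singComplex.obj X).d (n + 1) n (chainGen X x) =
      ∑ i : Fin (n + 2), (-1 : ℤ) ^ (i : ℕ) • chainGen X ((TopCat.toSSet.obj X).δ i x) := by
  have := congrArg (fun φ => φ.hom ⟨1⟩)
    ((TopCat.toSSet.obj X).ιChainComplex_d (ModuleCat.of ℤ (ULift.{u} ℤ)) x)
  exact this.trans (sum_zsmul_hom_apply _ _ _)

variable {X} in
lemma map_chainGen {Y : TopCat.{u}} (f : X ⟶ Y) {n : ℕ} (x : (TopCat.toSSet.obj X) _⦋n⦌) :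
    (singComplex.map f).f n (chainGen X x) = chainGen Y ((TopCat.toSSet.map f).app _ x) :=
  congrArg (fun φ => φ.hom ⟨1⟩)
    (SSet.ι_chainComplexMap_f _ _ (TopCat.toSSet.map f) (ModuleCat.of ℤ (ULift.{u} ℤ)) x)

/-- The comparison of Mathlib's singular chains with finitely supported functions. -/
noncomputable def toSingChain (n : ℕ) : (singComplex.obj X).X n →ₗ[ℤ] SingChain n X :=
  (((TopCat.toSSet.obj X).isColimitChainComplexXCofan (ModuleCat.of ℤ (ULift.{u} ℤ)) n).desc
    (Cofan.mk (ModuleCat.of ℤ (SingChain n X)) fun x => ModuleCat.ofHom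
      (Finsupp.lsingle (simplexEquiv X n x) ∘ₗ ULift.moduleEquiv.toLinearMap))).hom

lemma toSingChain_ι {n : ℕ} (x : (TopCat.toSSet.obj X) _⦋n⦌) (m : ULift.{u} ℤ) :
    toSingChain X n (((TopCat.toSSet.obj X).ιChainComplex
      (R := ModuleCat.of ℤ (ULift.{u} ℤ)) x).hom m) =
      Finsupp.single (simplexEquiv X n x) m.down :=
  congrArg (fun φ : ModuleCat.of ℤ (ULift.{u} ℤ) ⟶ ModuleCat.of ℤ (SingChain n X) => φ.hom m)
    (((TopCat.toSSet.obj X).isColimitChainComplexXCofan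
      (ModuleCat.of ℤ (ULift.{u} ℤ)) n).fac (Cofan.mk (ModuleCat.of ℤ (SingChain n X)) fun x =>
        ModuleCat.ofHom
          (Finsupp.lsingle (simplexEquiv X n x) ∘ₗ ULift.moduleEquiv.toLinearMap)) ⟨x⟩)

lemma toSingChain_chainGen {n : ℕ} (x : (TopCat.toSSet.obj X) _⦋n⦌) :
    toSingChain X n (chainGen X x) = Finsupp.single (simplexEquiv X n x) 1 :=
  toSingChain_ι X x _

/-- The inverse of the comparison map. -/
noncomputable def ofSingChain (n : ℕ) : SingChain n X →ₗ[ℤ] (singComplex.obj X).X n :=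
  Finsupp.linearCombination ℤ fun σ => chainGen X ((simplexEquiv X n).symm σ)

lemma smul_chainGen {n : ℕ} (x : (TopCat.toSSet.obj X) _⦋n⦌) (m : ULift.{u} ℤ) :
    m.down • chainGen X x = ((TopCat.toSSet.obj X).ιChainComplex
      (R := ModuleCat.of ℤ (ULift.{u} ℤ)) x).hom m := by
  have hm : m = m.down • (⟨1⟩ : ULift.{u} ℤ) := by
    ext
    simp
  conv_rhs => rw [hm]
  exact (map_zsmul ((TopCat.toSSet.obj X).ιChainComplex
      (R := ModuleCat.of ℤ (ULift.{u} ℤ)) x).hom m.down (⟨1⟩ : ULift.{u} ℤ)).symm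

/-- Mathlib's singular chains are the finitely supported functions on singular simplices. -/
noncomputable def chainEquiv (n : ℕ) : (singComplex.obj X).X n ≃ₗ[ℤ] SingChain n X :=
  LinearEquiv.ofLinearMap (toSingChain X n) (ofSingChain X n)
    (by
      refine Finsupp.lhom_ext' fun σ => LinearMap.ext_ring ?_
      simp [ofSingChain, toSingChain_chainGen])
    (by
      have : ModuleCat.ofHom (ofSingChain X n ∘ₗ toSingChain X n) = 𝟙 _ := by
        refine SSet.chainComplex_hom_ext fun x => ?_
        ext
        refine (congrArg (ofSingChain X n) (toSingChain_ι X x _)).trans ?_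
        rw [ofSingChain, Finsupp.linearCombination_single, Equiv.symm_apply_apply]
        exact (int_smul_eq_zsmul _ _ _).trans (smul_chainGen X x _)
      exact congrArg ModuleCat.Hom.hom this)

lemma chainEquiv_chainGen {n : ℕ} (x : (TopCat.toSSet.obj X) _⦋n⦌) :
    chainEquiv X n (chainGen X x) = Finsupp.single (simplexEquiv X n x) 1 :=
  toSingChain_chainGen X x

lemma singComplex_induction {n : ℕ} {p : (singComplex.obj X).X n → Prop} (h0 : p 0)
    (hadd : ∀ x y, p x → p y → p (x + y)) (hneg : ∀ (m : ℤ) x, p x → p (m • x))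
    (hgen : ∀ x, p (chainGen X x)) (z) : p z := by
  obtain ⟨c, rfl⟩ := (chainEquiv X n).symm.surjective z
  induction c using Finsupp.induction_linear with
  | zero => rwa [map_zero]
  | add x y hx hy => rw [map_add]; exact hadd _ _ hx hy
  | single σ m =>
    have : (chainEquiv X n).symm (Finsupp.single σ m) =
        m • chainGen X ((simplexEquiv X n).symm σ) := by
      rw [LinearEquiv.symm_apply_eq, map_zsmul, chainEquiv_chainGen, Equiv.apply_symm_apply,
        Finsupp.smul_single, smul_eq_mul, mul_one]
    rw [this]
    exact hneg _ _ (hgen _)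

lemma chainEquiv_d {n : ℕ} (z : (singComplex.obj X).X (n + 1)) :
    chainEquiv X n ((singComplex.obj X).d (n + 1) n z) =
      singBoundary n (chainEquiv X (n + 1) z) := by
  induction z using singComplex_induction with
  | h0 => simp only [map_zero]
  | hadd x y hx hy => simp only [map_add, hx, hy]
  | hneg m x hx => simp only [map_zsmul, hx]
  | hgen x =>
    rw [d_chainGen, chainEquiv_chainGen, singBoundary, altSum_single, map_sum]
    simp only [map_zsmul, chainEquiv_chainGen, simplexEquiv_δ]

variable {X} in
lemma chainEquiv_map {Y : TopCat.{u}} (f : X ⟶ Y) {n : ℕ} (z : (singComplex.obj X).X n) :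
    chainEquiv Y n ((singComplex.map f).f n z) =
      Finsupp.lmapDomain ℤ ℤ (fun σ => f.hom.comp σ) (chainEquiv X n z) := by
  induction z using singComplex_induction with
  | h0 => simp only [map_zero]
  | hadd x y hx hy => simp only [map_add, hx, hy]
  | hneg m x hx => simp only [map_zsmul, hx]
  | hgen x =>
    rw [map_chainGen, chainEquiv_chainGen, chainEquiv_chainGen, simplexEquiv_map,
      Finsupp.lmapDomain_apply, Finsupp.mapDomain_single]

end SingularComplex

end GraphConfig

namespace GraphConfig

open CategoryTheory Limits Simplicial

/-! ### Mayer–Vietoris for open sets, and the homology of basic spaces -/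

section Topology

variable {X : Type u} [TopologicalSpace X]

/-- The inclusion of a subspace in a larger one. -/
def subspaceIncl {S T : Set X} (h : S ⊆ T) : TopCat.of S ⟶ TopCat.of T :=
  TopCat.ofHom ⟨Set.inclusion h, continuous_inclusion h⟩

/-- The singular simplices of a subspace with image in a further subset. -/
def simplicesIn (S T : Set X) (n : ℕ) : Set C(Simplex n, T) := {σ | ∀ t, (σ t : X) ∈ S}

lemma comp_subspaceIncl_injective {S T : Set X} (h : S ⊆ T) (n : ℕ) :
    Function.Injective fun σ : C(Simplex n, S) => (subspaceIncl h).hom.comp σ := fun σ τ e => by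
  ext t
  exact congrArg (fun ρ : C(Simplex n, T) => (ρ t : X)) e

lemma singComplex_map_injective {S T : Set X} (h : S ⊆ T) (n : ℕ) :
    Function.Injective ((singComplex.map (subspaceIncl h)).f n) := fun x y e => by
  apply (chainEquiv _ n).injective
  apply Finsupp.mapDomain_injective (comp_subspaceIncl_injective h n)
  have := congrArg (chainEquiv _ n) e
  rwa [chainEquiv_map, chainEquiv_map] at this

lemma exists_singComplex_map_eq {S T : Set X} (h : S ⊆ T) {n : ℕ}
    (z : (singComplex.obj (TopCat.of T)).X n)
    (hz : chainEquiv _ n z ∈ Finsupp.supported ℤ ℤ (simplicesIn S T n)) :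
    ∃ x, (singComplex.map (subspaceIncl h)).f n x = z := by
  suffices H : ∃ c, Finsupp.lmapDomain ℤ ℤ (fun σ => (subspaceIncl h).hom.comp σ) c =
      chainEquiv (TopCat.of T) n z by
    obtain ⟨c, hc⟩ := H
    refine ⟨(chainEquiv _ n).symm c, (chainEquiv _ n).injective ?_⟩
    rw [chainEquiv_map, LinearEquiv.apply_symm_apply, hc]
  refine LinearMap.mem_range.1 (?_ : chainEquiv (TopCat.of T) n z ∈ LinearMap.range _)
  refine map_mem_of_mem_supported LinearMap.id _ _ (fun σ hσ => ?_) hz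
  refine ⟨Finsupp.single ⟨fun t => ⟨σ t, hσ t⟩,
    (continuous_subtype_val.comp σ.continuous).subtype_mk _⟩ 1, ?_⟩
  rw [Finsupp.lmapDomain_apply, Finsupp.mapDomain_single]
  rfl

lemma chainEquiv_map_mem_supported {S T : Set X} (h : S ⊆ T) {n : ℕ}
    (x : (singComplex.obj (TopCat.of S)).X n) :
    chainEquiv _ n ((singComplex.map (subspaceIncl h)).f n x) ∈
      Finsupp.supported ℤ ℤ (simplicesIn S T n) := by
  rw [chainEquiv_map]
  exact mapDomain_mem_supported _ _ _ fun σ _ t => (σ t).2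

/-- Mayer–Vietoris for the Euler characteristic of a union of two open subsets. -/
theorem hasFiniteHomology_union {A B : Set X} (hA : IsOpen A) (hB : IsOpen B)
    (fA : HasFiniteHomology A) (fB : HasFiniteHomology B)
    (fAB : HasFiniteHomology (A ∩ B : Set X)) :
    HasFiniteHomology (A ∪ B : Set X) ∧
      eulerChar (A ∪ B : Set X) + eulerChar (A ∩ B : Set X) = eulerChar A + eulerChar B := by
  have small : ∀ n (z : (singComplex.obj (TopCat.of (A ∪ B : Set X))).X n),
      chainEquiv _ n z ∈ smallChains (X := (A ∪ B : Set X)) (Subtype.val ⁻¹' A)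
        (Subtype.val ⁻¹' B) n ↔
      ∃ x y, z = (singComplex.map (subspaceIncl (Set.subset_union_left : A ⊆ A ∪ B))).f n x +
        (singComplex.map (subspaceIncl (Set.subset_union_right : B ⊆ A ∪ B))).f n y := by
    intro n z
    have e : smallSimplices (X := (A ∪ B : Set X)) (Subtype.val ⁻¹' A) (Subtype.val ⁻¹' B) n =
        simplicesIn A (A ∪ B) n ∪ simplicesIn B (A ∪ B) n := rfl
    rw [smallChains, e, Finsupp.supported_union, Submodule.mem_sup]
    constructor
    · rintro ⟨c, hc, d, hd, hcd⟩
      obtain ⟨x, hx⟩ := exists_singComplex_map_eq (Set.subset_union_left : A ⊆ A ∪ B)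
        ((chainEquiv _ n).symm c) (by rwa [LinearEquiv.apply_symm_apply])
      obtain ⟨y, hy⟩ := exists_singComplex_map_eq (Set.subset_union_right : B ⊆ A ∪ B)
        ((chainEquiv _ n).symm d) (by rwa [LinearEquiv.apply_symm_apply])
      refine ⟨x, y, ?_⟩
      rw [hx, hy, ← map_add, hcd, LinearEquiv.symm_apply_apply]
    · rintro ⟨x, y, rfl⟩
      exact ⟨_, chainEquiv_map_mem_supported _ x, _, chainEquiv_map_mem_supported _ y,
        (map_add _ _ _).symm⟩
  have cover : ∀ x : (A ∪ B : Set X), x ∈ (Subtype.val ⁻¹' A : Set (A ∪ B : Set X)) ∨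
      x ∈ (Subtype.val ⁻¹' B : Set (A ∪ B : Set X)) := fun x => x.2
  refine finiteHomology_of_square
    (singComplex.map (subspaceIncl (Set.inter_subset_left : A ∩ B ⊆ A)))
    (singComplex.map (subspaceIncl (Set.inter_subset_right : A ∩ B ⊆ B)))
    (singComplex.map (subspaceIncl (Set.subset_union_left : A ⊆ A ∪ B)))
    (singComplex.map (subspaceIncl (Set.subset_union_right : B ⊆ A ∪ B)))
    ?_ (singComplex_map_injective _) (singComplex_map_injective _) ?_ ?_ ?_ fAB fA fB
  · rw [← Functor.map_comp, ← Functor.map_comp]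
    rfl
  · intro n x y hxy
    refine exists_singComplex_map_eq _ x fun σ hσ => ?_
    have h1 := chainEquiv_map_mem_supported (Set.subset_union_right : B ⊆ A ∪ B) y
    rw [← hxy, chainEquiv_map] at h1
    classical
    -- Inclusion is injective on singular simplices, so nothing cancels: every simplex of `x`
    -- survives in the common image and hence lies in `B` as well.
    have h2 := h1 (a := (subspaceIncl (Set.subset_union_left : A ⊆ A ∪ B)).hom.comp σ) (by
      rw [Finsupp.lmapDomain_apply, Finset.mem_coe,
        Finsupp.mapDomain_support_of_injective (comp_subspaceIncl_injective _ n)]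
      exact Finset.mem_image_of_mem _ hσ)
    exact fun t => ⟨(σ t).2, h2 t⟩
  · intro z
    rw [← small]
    exact mem_smallChains_zero cover _
  · intro n z hz
    rw [← small, chainEquiv_d] at hz
    obtain ⟨w, hw⟩ := exists_sub_singBoundary_mem_smallChains
      (hA.preimage continuous_subtype_val) (hB.preimage continuous_subtype_val) cover _ hz
    have hw' : chainEquiv (TopCat.of (A ∪ B : Set X)) (n + 1) (z - (singComplex.obj _).d (n + 2) (n + 1)
        ((chainEquiv _ (n + 2)).symm w)) ∈ smallChains (X := (A ∪ B : Set X)) (Subtype.val ⁻¹' A)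
        (Subtype.val ⁻¹' B) (n + 1) := by
      rwa [map_sub, chainEquiv_d, LinearEquiv.apply_symm_apply]
    obtain ⟨x, y, hxy⟩ := (small _ _).1 hw'
    exact ⟨_, x, y, by rw [add_assoc, ← hxy, add_sub_cancel]⟩

/-! ### Contractible and empty spaces -/

lemma homologyGroup_equiv_of_homeomorph {Y : Type u} [TopologicalSpace Y] (e : X ≃ₜ Y) (n : ℕ) :
    Nonempty (homologyGroup n X ≃ₗ[ℤ] homologyGroup n Y) :=
  ⟨(((AlgebraicTopology.singularHomologyFunctor (ModuleCat.{u} ℤ) n).obj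
    (ModuleCat.of ℤ (ULift.{u} ℤ))).mapIso
      (TopCat.isoOfHomeo (X := TopCat.of X) (Y := TopCat.of Y) e)).toLinearEquiv⟩

lemma hasFiniteHomology_of_homeomorph {Y : Type u} [TopologicalSpace Y] (e : X ≃ₜ Y)
    (h : HasFiniteHomology X) : HasFiniteHomology Y ∧ eulerChar Y = eulerChar X :=
  FiniteHomology.of_isIso (homologyGroup_equiv_of_homeomorph e) h

lemma hasFiniteHomology_of_isEmpty [IsEmpty X] : HasFiniteHomology X ∧ eulerChar X = 0 := by
  have h : ∀ n, Subsingleton (homologyGroup n X) := fun n => by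
    have : IsEmpty C(Simplex n, TopCat.of X) :=
      ⟨fun σ => IsEmpty.false (α := X) (σ (vertices n 0))⟩
    have hz : IsZero ((singComplex.obj (TopCat.of X)).X n) :=
      ModuleCat.isZero_of_iff_subsingleton.2 (chainEquiv (TopCat.of X) n).toEquiv.subsingleton
    exact ModuleCat.subsingleton_of_isZero
      (HomologicalComplex.ExactAt.isZero_homology (ShortComplex.exact_of_isZero_X₂ _ hz))
  refine ⟨⟨fun n => have := h n; inferInstance, 0, fun n _ => h n⟩, ?_⟩
  exact (homologyChi_eq_sum (N := 0) fun n _ => h n).trans (Finset.sum_range_zero _)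

/-- In positive degrees the identity on homology factors through the zero homology of a point; in
degree zero the augmentation is an isomorphism. -/
lemma hasFiniteHomology_of_contractible [ContractibleSpace X] :
    HasFiniteHomology X ∧ eulerChar X = 1 := by
  have h : ∀ n, 1 ≤ n → Subsingleton (homologyGroup n X) := fun n hn => by
    obtain ⟨y, ⟨H⟩⟩ := id_nullhomotopic X
    let F := (AlgebraicTopology.singularHomologyFunctor (ModuleCat.{u} ℤ) n).obj
      (ModuleCat.of ℤ (ULift.{u} ℤ))
    let p : TopCat.of X ⟶ TopCat.of PUnit.{u + 1} := TopCat.ofHom (ContinuousMap.const X PUnit.unit)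
    let q : TopCat.of PUnit.{u + 1} ⟶ TopCat.of X := TopCat.ofHom (ContinuousMap.const _ y)
    have h1 : F.map (𝟙 (TopCat.of X)) = F.map (p ≫ q) :=
      TopCat.Homotopy.congr_homologyMap_singularChainComplexFunctor
        (f := 𝟙 (TopCat.of X)) (g := p ≫ q) H _ n
    have hz : IsZero (F.obj (TopCat.of PUnit.{u + 1})) :=
      AlgebraicTopology.isZero_singularHomologyFunctor_of_totallyDisconnectedSpace
          (ModuleCat.{u} ℤ) n _ (TopCat.of PUnit.{u + 1}) (by omega)
    refine ModuleCat.subsingleton_of_isZero ((IsZero.iff_id_eq_zero (F.obj (TopCat.of X))).2 ?_)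
    rw [← F.map_id, h1, F.map_comp, hz.eq_of_tgt (F.map p) 0, zero_comp]
  have e : homologyGroup 0 X ≃ₗ[ℤ] ULift.{u} ℤ := by
    have : PathConnectedSpace (TopCat.of X) := inferInstanceAs (PathConnectedSpace X)
    exact (asIso ((TopCat.of X).singularHomology₀ε (ModuleCat.of ℤ (ULift.{u} ℤ)))).toLinearEquiv
  refine ⟨⟨fun n => ?_, 1, h⟩, ?_⟩
  · cases n with
    | zero => exact Module.Finite.equiv e.symm
    | succ n => have := h (n + 1) (by omega); infer_instance
  · refine (homologyChi_eq_sum (N := 1) h).trans ?_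
    rw [Finset.sum_range_one]
    have : Module.finrank ℤ (homologyGroup 0 X) = 1 := by
      rw [e.finrank_eq, ULift.moduleEquiv.finrank_eq, Module.finrank_self]
    change (-1 : ℤ) ^ 0 * (Module.finrank ℤ (homologyGroup 0 X) : ℤ) = 1
    rw [this]
    rfl

end Topology

end GraphConfig

namespace GraphConfig

/-! ### Euler characteristics of stratified spaces -/

section Stratification

variable {X : Type u} [TopologicalSpace X] {P : Type*} [PartialOrder P] [Fintype P]

-- Induction on the size of `T`: for `p` minimal in `T`, the preimage of `T` is the union of the
-- preimage of `T.erase p` and the star of `p`. Their intersection is `{x | p < s x}`, which comes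
-- from a smaller upper set, so Mayer–Vietoris applies.
open Classical in
lemma hasFiniteHomology_of_isUpperSet (s : X → P) (hopen : ∀ p, IsOpen {x | p ≤ s x})
    (hfin : ∀ p, HasFiniteHomology {x | p ≤ s x}) (T : Finset P) (hT : IsUpperSet (T : Set P)) :
    HasFiniteHomology {x | s x ∈ T} ∧ eulerChar {x | s x ∈ T} =
      ∑ p ∈ T, (eulerChar {x | p ≤ s x} - eulerChar {x | p < s x}) := by
  induction hn : T.card using Nat.strong_induction_on generalizing T with
  | _ n ih =>
    obtain rfl | hne := T.eq_empty_or_nonempty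
    · have : IsEmpty {x | s x ∈ (∅ : Finset P)} := ⟨fun x => Finset.notMem_empty _ x.2⟩
      rw [Finset.sum_empty]
      exact hasFiniteHomology_of_isEmpty
    · obtain ⟨p, hp⟩ := T.exists_minimal hne
      have hpT : p ∈ T := hp.prop
      have hup : IsUpperSet ((T.erase p : Finset P) : Set P) := fun a b hab ha => by
        rw [Finset.mem_coe, Finset.mem_erase] at ha ⊢
        refine ⟨fun hb => ha.1 (le_antisymm (hb ▸ hab) ?_), hT hab ha.2⟩
        exact hp.le_of_le ha.2 (hb ▸ hab)
      have hcard : (T.erase p).card < n := hn ▸ Finset.card_erase_lt_of_mem hpT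
      obtain ⟨f₁, e₁⟩ := ih _ hcard (T.erase p) hup rfl
      have hsub : Finset.univ.filter (fun q => p < q) ⊆ T.erase p := fun q hq => by
        have hq := (Finset.mem_filter.1 hq).2
        exact Finset.mem_erase.2 ⟨hq.ne', hT hq.le hpT⟩
      obtain ⟨f₂, -⟩ := ih _ ((Finset.card_le_card hsub).trans_lt hcard)
        (Finset.univ.filter fun q => p < q) (fun a b hab ha => by
          simp only [Finset.coe_filter, Finset.mem_univ, true_and, Set.mem_ofPred_eq] at ha ⊢
          exact ha.trans_le hab) rfl
      have hinter : {x | s x ∈ T.erase p} ∩ {x | p ≤ s x} = {x | p < s x} := by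
        ext x
        constructor
        · rintro ⟨h1, h2⟩
          exact lt_of_le_of_ne h2 (Finset.ne_of_mem_erase h1).symm
        · exact fun h => ⟨Finset.mem_erase.2 ⟨ne_of_gt h, hT (le_of_lt h) hpT⟩, le_of_lt h⟩
      have hunion : {x | s x ∈ T.erase p} ∪ {x | p ≤ s x} = {x | s x ∈ T} := by
        ext x
        constructor
        · rintro (h | h)
          · exact Finset.mem_of_mem_erase h
          · exact hT h hpT
        · intro h
          by_cases hx : s x = p
          · exact Or.inr hx.ge
          · exact Or.inl (Finset.mem_erase.2 ⟨hx, h⟩)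
      have hO : IsOpen {x | s x ∈ T.erase p} := by
        have : {x | s x ∈ T.erase p} = ⋃ q ∈ T.erase p, {x | q ≤ s x} := by
          ext x
          simp only [Set.mem_ofPred_eq, Set.mem_iUnion, exists_prop]
          exact ⟨fun h => ⟨s x, h, le_rfl⟩, fun ⟨q, hq, hqx⟩ => hup hqx hq⟩
        rw [this]
        exact isOpen_biUnion fun q _ => hopen q
      have f₂' : HasFiniteHomology {x | p < s x} := by
        have : {x | s x ∈ Finset.univ.filter fun q => p < q} = {x | p < s x} := by
          ext x
          simp
        rwa [this] at f₂
      have := hasFiniteHomology_union hO (hopen p) f₁ (hfin p) (by rwa [hinter])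
      rw [hunion, hinter] at this
      refine ⟨this.1, ?_⟩
      rw [← Finset.add_sum_erase _ _ hpT, ← e₁]
      linarith [this.2]

/-- The Euler characteristic of a space stratified by a finite poset such that the open stars of the
strata are contractible. -/
theorem eulerChar_of_stratification [DecidableLE P] (s : X → P) (hopen : ∀ p, IsOpen {x | p ≤ s x})
    (hcontr : ∀ p, ContractibleSpace {x | p ≤ s x}) (k : P → ℤ)
    (hk : ∀ x, ∑ p with p ≤ s x, k p = 1) :
    HasFiniteHomology X ∧ eulerChar X = ∑ p, k p := by
  classical
  have hfin : ∀ p, HasFiniteHomology {x | p ≤ s x} := fun p =>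
    hasFiniteHomology_of_contractible.1
  have key := hasFiniteHomology_of_isUpperSet s hopen hfin
  set c : P → ℤ := fun p => eulerChar {x | p ≤ s x} - eulerChar {x | p < s x} with hc
  have hstar : ∀ p, ∑ q with p ≤ q, c q = 1 := fun p => by
    have hset : {x | s x ∈ Finset.univ.filter fun q => p ≤ q} = {x | p ≤ s x} := by
      ext x
      simp
    rw [← (key (Finset.univ.filter fun q => p ≤ q) (fun a b hab ha => by
      simp only [Finset.coe_filter, Finset.mem_univ, true_and, Set.mem_ofPred_eq] at ha ⊢
      exact ha.trans hab)).2]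
    rw [hset]
    exact hasFiniteHomology_of_contractible.2
  -- The weights are normalized only below values of `s`, so elements of the poset that are not
  -- attained must contribute nothing.
  have hzero : ∀ q, (∀ x, s x ≠ q) → c q = 0 := fun q hq => by
    have : {x | q ≤ s x} = {x | q < s x} := by
      ext x
      exact ⟨fun h => lt_of_le_of_ne h (hq x).symm, le_of_lt⟩
    rw [hc]
    dsimp only
    rw [this, sub_self]
  obtain ⟨f, e⟩ := key Finset.univ (by rw [Finset.coe_univ]; exact isUpperSet_univ)
  let φ : {x | s x ∈ (Finset.univ : Finset P)} ≃ₜ X :=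
    (Homeomorph.setCongr (by ext x; simp)).trans (Homeomorph.Set.univ X)
  obtain ⟨f', e'⟩ := hasFiniteHomology_of_homeomorph φ f
  refine ⟨f', e'.trans (e.trans ?_)⟩
  -- Double count of `k p * c q` over `p ≤ q`: `k` sums to 1 below each attained `q`, and `c` sums
  -- to 1 above each `p` because the star of `p` is contractible.
  calc ∑ q, c q = ∑ q, (∑ p with p ≤ q, k p) * c q := by
        refine Finset.sum_congr rfl fun q _ => ?_
        by_cases hq : ∃ x, s x = q
        · obtain ⟨x, rfl⟩ := hq
          rw [hk, one_mul]
        · push Not at hq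
          rw [hzero q hq, mul_zero]
    _ = ∑ p, k p * ∑ q with p ≤ q, c q := by
        simp only [Finset.sum_mul, Finset.mul_sum, Finset.sum_filter]
        rw [Finset.sum_comm]
        refine Finset.sum_congr rfl fun p _ => Finset.sum_congr rfl fun q _ => ?_
        split_ifs <;> simp
    _ = ∑ p, k p := by simp only [hstar, mul_one]

end Stratification

end GraphConfig

namespace GraphConfig

/-! ### Stratifications of the graph and of its configuration space -/

section Realization

variable {V : Type u} [Fintype V] (G : SimpleGraph V)

/-- The faces of a graph, as a one-dimensional simplicial complex. -/
def IsFace (A : Finset V) : Prop :=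
  A.Nonempty ∧ ((∃ v, ∀ w ∈ A, w = v) ∨ ∃ a b, G.Adj a b ∧ ∀ w ∈ A, w = a ∨ w = b)

omit [Fintype V] in
variable {G} in
lemma IsFace.mono {A B : Finset V} (hB : IsFace G B) (hA : A.Nonempty) (h : A ⊆ B) :
    IsFace G A :=
  ⟨hA, hB.2.imp (fun ⟨v, hv⟩ => ⟨v, fun w hw => hv w (h hw)⟩)
    fun ⟨a, b, hab, hw⟩ => ⟨a, b, hab, fun w hwA => hw w (h hwA)⟩⟩

/-- The smallest face containing a point. -/
noncomputable def carrier (x : V → ℝ) : Finset V :=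
  have := Classical.decPred fun v => x v ≠ 0
  Finset.univ.filter fun v => x v ≠ 0

lemma mem_carrier {x : V → ℝ} {v : V} : v ∈ carrier x ↔ x v ≠ 0 := by
  simp [carrier]

lemma mem_realization_iff {x : V → ℝ} :
    x ∈ realization G ↔ x ∈ stdSimplex ℝ V ∧ IsFace G (carrier x) := by
  simp only [IsFace, mem_carrier]
  refine and_congr_right fun hx => ⟨fun h => ⟨?_, h⟩, fun h => h.2⟩
  by_contra hne
  rw [Finset.not_nonempty_iff_eq_empty, Finset.eq_empty_iff_forall_notMem] at hne
  have : ∑ v, x v = 0 := Finset.sum_eq_zero fun v _ => by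
    simpa only [mem_carrier, not_not] using hne v
  rw [hx.2] at this
  exact one_ne_zero this

open Classical in
/-- The barycenter of a face. -/
noncomputable def faceCenter (A : Finset V) : V → ℝ := fun v => if v ∈ A then (A.card : ℝ)⁻¹ else 0

lemma carrier_faceCenter {A : Finset V} : carrier (faceCenter A) = A := by
  ext v
  rw [mem_carrier, faceCenter]
  constructor
  · intro h
    by_contra hv
    exact h (if_neg hv)
  · intro h
    rw [if_pos h]
    have : 0 < A.card := Finset.card_pos.2 ⟨v, h⟩
    positivity

omit [Fintype V] in
lemma faceCenter_pos {A : Finset V} {v : V} (hv : v ∈ A) : 0 < faceCenter A v := by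
  have : 0 < A.card := Finset.card_pos.2 ⟨v, hv⟩
  rw [faceCenter, if_pos hv]
  positivity

omit [Fintype V] in
lemma faceCenter_eq_zero {A : Finset V} {v : V} (hv : v ∉ A) : faceCenter A v = 0 := if_neg hv

lemma faceCenter_mem_stdSimplex {A : Finset V} (hA : A.Nonempty) :
    faceCenter A ∈ stdSimplex ℝ V := by
  refine ⟨fun v => ?_, ?_⟩
  · rw [faceCenter]
    split_ifs <;> positivity
  · have : (A.card : ℝ) ≠ 0 := Nat.cast_ne_zero.2 hA.card_pos.ne'
    simp [faceCenter, this]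

variable {G}

lemma faceCenter_mem_realization {A : Finset V} (hA : IsFace G A) :
    faceCenter A ∈ realization G :=
  (mem_realization_iff G).2 ⟨faceCenter_mem_stdSimplex hA.1, by rwa [carrier_faceCenter]⟩

/-- Since `A` lies in the support of `x`, moving towards its barycenter never leaves the face
carrying `x`. -/
lemma combo_mem_realization {A : Finset V} (hA : IsFace G A) {x : V → ℝ}
    (hx : x ∈ realization G) (hAx : A ⊆ carrier x) {a b : ℝ} (ha : 0 ≤ a) (hb : 0 ≤ b)
    (hab : a + b = 1) : a • faceCenter A + b • x ∈ realization G := by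
  have hs := convex_stdSimplex ℝ V (faceCenter_mem_stdSimplex hA.1) hx.1 ha hb hab
  refine ⟨hs, ?_⟩
  have hne : ∀ w, (a • faceCenter A + b • x) w ≠ 0 → x w ≠ 0 := fun w hw h => by
    have hwA : w ∉ A := fun hwA => mem_carrier.1 (hAx hwA) h
    exact hw (by simp [h, faceCenter_eq_zero hwA])
  exact hx.2.imp (fun ⟨v, hv⟩ => ⟨v, fun w hw => hv w (hne w hw)⟩)
    fun ⟨c, d, hcd, hv⟩ => ⟨c, d, hcd, fun w hw => hv w (hne w hw)⟩

lemma contractibleSpace_of_isEmbedding {Y E : Type*} [TopologicalSpace Y] [AddCommGroup E]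
    [Module ℝ E] [TopologicalSpace E] [ContinuousAdd E] [ContinuousSMul ℝ E] {j : Y → E}
    (hj : Topology.IsEmbedding j) {x : E} (hx : x ∈ Set.range j)
    (h : StarConvex ℝ x (Set.range j)) : ContractibleSpace Y := by
  have := h.contractibleSpace ⟨x, hx⟩
  exact hj.toHomeomorph.contractibleSpace

variable (G)

lemma isOpen_subset_carrier (A : Finset V) :
    IsOpen {x : realization G | A ⊆ carrier (x : V → ℝ)} := by
  have : {x : realization G | A ⊆ carrier (x : V → ℝ)} =
      ⋂ v ∈ A, {x : realization G | (x : V → ℝ) v ≠ 0} := by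
    ext x
    simp only [Set.mem_iInter, Set.mem_ofPred_eq, Finset.subset_iff, mem_carrier]
  rw [this]
  exact isOpen_biInter_finset fun v _ =>
    isOpen_ne_fun ((continuous_apply v).comp continuous_subtype_val) continuous_const

lemma contractibleSpace_subset_carrier {A : Finset V} (hA : IsFace G A) :
    ContractibleSpace {x : realization G | A ⊆ carrier (x : V → ℝ)} := by
  have hj : Topology.IsEmbedding
      fun z : {x : realization G | A ⊆ carrier (x : V → ℝ)} => ((z : realization G) : V → ℝ) :=
    Topology.IsEmbedding.subtypeVal.comp Topology.IsEmbedding.subtypeVal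
  have hrange : ∀ x : V → ℝ, x ∈ Set.range
      (fun z : {x : realization G | A ⊆ carrier (x : V → ℝ)} => ((z : realization G) : V → ℝ)) ↔
      x ∈ realization G ∧ A ⊆ carrier x := fun x =>
    ⟨by rintro ⟨z, rfl⟩; exact ⟨z.1.2, z.2⟩, fun h => ⟨⟨⟨x, h.1⟩, h.2⟩, rfl⟩⟩
  refine contractibleSpace_of_isEmbedding hj (x := faceCenter A) ?_ ?_
  · rw [hrange]
    exact ⟨faceCenter_mem_realization hA, carrier_faceCenter.ge⟩
  · intro x hx a b ha hb hab
    rw [hrange] at hx ⊢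
    refine ⟨combo_mem_realization hA hx.1 hx.2 ha hb hab, fun v hv => mem_carrier.2 ?_⟩
    have h1 : 0 < x v := lt_of_le_of_ne (hx.1.1.1 v) (mem_carrier.1 (hx.2 hv)).symm
    have h2 := faceCenter_pos hv
    have : 0 < a * faceCenter A v + b * x v := by
      rcases ha.eq_or_lt with rfl | ha
      · rw [zero_add] at hab
        simpa [hab] using h1
      · positivity
    simpa using this.ne'

/-- The set of vertices at which the first point has the larger barycentric coordinate. -/
noncomputable def excess (x y : V → ℝ) : Finset V :=
  have := Classical.decPred fun v => y v < x v
  Finset.univ.filter fun v => y v < x v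

lemma mem_excess {x y : V → ℝ} {v : V} : v ∈ excess x y ↔ y v < x v := by
  simp [excess]

lemma disjoint_excess (x y : V → ℝ) : Disjoint (excess x y) (excess y x) :=
  Finset.disjoint_left.2 fun _ h h' => lt_asymm (mem_excess.1 h) (mem_excess.1 h')

variable {G}

lemma excess_subset_carrier {x y : V → ℝ} (hy : y ∈ realization G) :
    excess x y ⊆ carrier x := fun v hv =>
  mem_carrier.2 ((hy.1.1 v).trans_lt (mem_excess.1 hv)).ne'

/-- Both coordinate vectors sum to 1, so distinct points cannot satisfy `x ≤ y` everywhere and the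
excess is nonempty. It lies in the support of `x` because `y ≥ 0`. -/
lemma isFace_excess {x y : V → ℝ} (hx : x ∈ realization G) (hy : y ∈ realization G)
    (hxy : x ≠ y) : IsFace G (excess x y) := by
  refine ((mem_realization_iff G).1 hx).2.mono ?_ (excess_subset_carrier hy)
  by_contra hne
  have hle : ∀ v ∈ Finset.univ, x v ≤ y v := fun v _ => by
    by_contra! h
    exact hne ⟨v, mem_excess.2 h⟩
  have hsum : ∑ v, x v = ∑ v, y v := hx.1.2.trans hy.1.2.symm
  exact hxy (funext fun v => (Finset.sum_eq_sum_iff_of_le hle).1 hsum v (Finset.mem_univ v))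

variable (G)

/-- The pairs of distinct points that are separated by two given sets of vertices. -/
def separated (A B : Finset V) : Set (ConfigTwo (realization G)) :=
  {z | A ⊆ excess (z.1.1 : V → ℝ) z.1.2 ∧ B ⊆ excess (z.1.2 : V → ℝ) z.1.1}

lemma isOpen_separated (A B : Finset V) : IsOpen (separated G A B) := by
  have : separated G A B =
      (⋂ v ∈ A, {z | (z.1.2 : V → ℝ) v < (z.1.1 : V → ℝ) v}) ∩
        ⋂ v ∈ B, {z | (z.1.1 : V → ℝ) v < (z.1.2 : V → ℝ) v} := by
    ext z
    simp only [separated, Set.mem_inter_iff, Set.mem_iInter, Set.mem_ofPred_eq, Finset.subset_iff,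
      mem_excess]
  rw [this]
  have h1 : ∀ v, Continuous fun z : ConfigTwo (realization G) => (z.1.1 : V → ℝ) v := fun v =>
    (continuous_apply v).comp (continuous_subtype_val.comp
      (continuous_fst.comp continuous_subtype_val))
  have h2 : ∀ v, Continuous fun z : ConfigTwo (realization G) => (z.1.2 : V → ℝ) v := fun v =>
    (continuous_apply v).comp (continuous_subtype_val.comp
      (continuous_snd.comp continuous_subtype_val))
  exact (isOpen_biInter_finset fun v _ => isOpen_lt (h2 v) (h1 v)).inter
    (isOpen_biInter_finset fun v _ => isOpen_lt (h1 v) (h2 v))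

omit [Fintype V] in
lemma combo_lt_combo {A B : Finset V} (hAB : Disjoint A B) {x y : V → ℝ} {a b : ℝ} (ha : 0 ≤ a)
    (hb : 0 ≤ b) (hab : a + b = 1) {v : V} (hv : v ∈ A) (hxy : y v < x v) :
    (a • faceCenter B + b • y) v < (a • faceCenter A + b • x) v := by
  have h1 := faceCenter_pos hv
  have h2 := faceCenter_eq_zero (Finset.disjoint_left.1 hAB hv)
  simp only [Pi.add_apply, Pi.smul_apply, smul_eq_mul, h2, mul_zero, zero_add]
  rcases ha.eq_or_lt with rfl | ha
  · rw [zero_add] at hab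
    simpa [hab] using hxy
  · have := mul_pos ha h1
    have := mul_le_mul_of_nonneg_left hxy.le hb
    linarith

/-- The set is star-shaped about the pair of barycenters of `A` and `B`. As `A` and `B` are
disjoint, each barycenter vanishes on the other face, so the strict inequalities persist along
segments and the points never collide. -/
lemma contractibleSpace_separated {A B : Finset V} (hA : IsFace G A) (hB : IsFace G B)
    (hAB : Disjoint A B) : ContractibleSpace (separated G A B) := by
  let j : separated G A B → (V → ℝ) × (V → ℝ) := fun z => (z.1.1.1, z.1.1.2)
  have hj : Topology.IsEmbedding j :=
    (Topology.IsEmbedding.subtypeVal.prodMap Topology.IsEmbedding.subtypeVal).comp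
      (Topology.IsEmbedding.subtypeVal.comp Topology.IsEmbedding.subtypeVal)
  have hrange : ∀ p, p ∈ Set.range j ↔ p.1 ∈ realization G ∧ p.2 ∈ realization G ∧
      (∀ v ∈ A, p.2 v < p.1 v) ∧ ∀ v ∈ B, p.1 v < p.2 v := by
    intro p
    constructor
    · rintro ⟨z, rfl⟩
      exact ⟨z.1.1.1.2, z.1.1.2.2, fun v hv => mem_excess.1 (z.2.1 hv),
        fun v hv => mem_excess.1 (z.2.2 hv)⟩
    · rintro ⟨h1, h2, h3, h4⟩
      obtain ⟨v, hv⟩ := hA.1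
      have hne : (⟨p.1, h1⟩ : realization G) ≠ ⟨p.2, h2⟩ := fun e =>
        (h3 v hv).ne' (congrFun (congrArg Subtype.val e) v)
      exact ⟨⟨⟨(⟨p.1, h1⟩, ⟨p.2, h2⟩), hne⟩, fun v hv => mem_excess.2 (h3 v hv),
        fun v hv => mem_excess.2 (h4 v hv)⟩, rfl⟩
  refine contractibleSpace_of_isEmbedding hj (x := (faceCenter A, faceCenter B)) ?_ ?_
  · rw [hrange]
    refine ⟨faceCenter_mem_realization hA, faceCenter_mem_realization hB, fun v hv => ?_,
      fun v hv => ?_⟩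
    · dsimp only
      rw [faceCenter_eq_zero (Finset.disjoint_left.1 hAB hv)]
      exact faceCenter_pos hv
    · dsimp only
      rw [faceCenter_eq_zero (Finset.disjoint_right.1 hAB hv)]
      exact faceCenter_pos hv
  · intro p hp a b ha hb hab
    rw [hrange] at hp ⊢
    obtain ⟨h1, h2, h3, h4⟩ := hp
    refine ⟨combo_mem_realization hA h1 (fun v hv => ?_) ha hb hab,
      combo_mem_realization hB h2 (fun v hv => ?_) ha hb hab,
      fun v hv => combo_lt_combo hAB ha hb hab hv (h3 v hv),
      fun v hv => combo_lt_combo hAB.symm ha hb hab hv (h4 v hv)⟩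
    · exact mem_carrier.2 ((h2.1.1 v).trans_lt (h3 v hv)).ne'
    · exact mem_carrier.2 ((h1.1.1 v).trans_lt (h4 v hv)).ne'

end Realization

end GraphConfig

namespace GraphConfig

/-! ### Signed counts of faces and of disjoint pairs of faces -/

section Counting

variable {V : Type u} [Fintype V] (G : SimpleGraph V)

/-- The sign `(-1) ^ dim A` of a face. -/
def faceSign (A : Finset V) : ℤ := (-1) ^ (A.card + 1)

open Classical in
/-- The finite set of faces of a graph. -/
noncomputable def faces : Finset (Finset V) := Finset.univ.filter (IsFace G)

lemma mem_faces {A : Finset V} : A ∈ faces G ↔ IsFace G A := by simp [faces]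

lemma sum_subtype_filter {T : Type*} [Fintype T] (Q : T → Prop) [DecidablePred Q]
    (p : T → Prop) [DecidablePred p] (f : T → ℤ) :
    ∑ a : {a // Q a} with p a.1, f a = ∑ a with Q a ∧ p a, f a := by
  rw [Finset.sum_filter, ← Finset.filter_filter, Finset.sum_filter (p := p)]
  exact (Finset.sum_subtype (Finset.univ.filter Q) (by simp) fun a => if p a then f a else 0).symm

variable {G}

-- Every nonempty subset of a face is a face, so this is the vanishing of the alternating sum over
-- all subsets of `B`, with the empty set split off.
open Classical in
lemma sum_faceSign_below {B : Finset V} (hB : IsFace G B) :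
    ∑ A with IsFace G A ∧ A ⊆ B, faceSign A = 1 := by
  have e : Finset.univ.filter (fun A => IsFace G A ∧ A ⊆ B) = B.powerset.erase ∅ := by
    ext A
    simp only [Finset.mem_filter, Finset.mem_univ, true_and, Finset.mem_erase,
      Finset.mem_powerset, ← Finset.nonempty_iff_ne_empty]
    exact ⟨fun h => ⟨h.1.1, h.2⟩, fun h => ⟨hB.mono h.1 h.2, h.2⟩⟩
  rw [e]
  have h := Finset.sum_powerset_neg_one_pow_card_of_nonempty hB.1
  rw [← Finset.add_sum_erase _ _ (Finset.empty_mem_powerset B), Finset.card_empty, pow_zero] at h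
  simp only [faceSign, pow_succ, mul_neg_one, Finset.sum_neg_distrib]
  linarith

variable (G)

theorem eulerChar_realization :
    HasFiniteHomology (realization G) ∧
      eulerChar (realization G) = ∑ A ∈ faces G, faceSign A := by
  classical
  let s : realization G → {A : Finset V // IsFace G A} := fun x =>
    ⟨carrier x.1, ((mem_realization_iff G).1 x.2).2⟩
  obtain ⟨f, e⟩ := eulerChar_of_stratification s (fun p => isOpen_subset_carrier G p.1)
    (fun p => contractibleSpace_subset_carrier G p.2) (fun p => faceSign p.1) (fun x =>
      (sum_subtype_filter (IsFace G) (fun A => A ⊆ (s x).1) faceSign).trans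
        (sum_faceSign_below (s x).2))
  refine ⟨f, e.trans ?_⟩
  exact (Finset.sum_subtype (faces G) (fun _ => mem_faces G) faceSign).symm

open Classical in
theorem eulerChar_configTwo :
    HasFiniteHomology (ConfigTwo (realization G)) ∧
      eulerChar (ConfigTwo (realization G)) =
        ∑ p ∈ faces G ×ˢ faces G with Disjoint p.1 p.2, faceSign p.1 * faceSign p.2 := by
  let Q : Finset V × Finset V → Prop := fun p => IsFace G p.1 ∧ IsFace G p.2 ∧ Disjoint p.1 p.2
  let s : ConfigTwo (realization G) → {p // Q p} := fun z =>
    ⟨(excess z.1.1 z.1.2, excess z.1.2 z.1.1),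
      isFace_excess z.1.1.2 z.1.2.2 fun h => z.2 (Subtype.ext h),
      isFace_excess z.1.2.2 z.1.1.2 fun h => z.2 (Subtype.ext h.symm), disjoint_excess _ _⟩
  obtain ⟨f, e⟩ := eulerChar_of_stratification s (fun p => isOpen_separated G p.1.1 p.1.2)
    (fun p => contractibleSpace_separated G p.2.1 p.2.2.1 p.2.2.2)
    (fun p => faceSign p.1.1 * faceSign p.1.2) (fun x => by
      refine (sum_subtype_filter Q (fun p => p ≤ (s x).1)
        fun p => faceSign p.1 * faceSign p.2).trans ?_
      have e : Finset.univ.filter (fun p => Q p ∧ p ≤ (s x).1) =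
          Finset.univ.filter (fun A => IsFace G A ∧ A ⊆ (s x).1.1) ×ˢ
            Finset.univ.filter (fun A => IsFace G A ∧ A ⊆ (s x).1.2) := by
        ext ⟨A, B⟩
        simp only [Finset.mem_filter, Finset.mem_univ, true_and, Finset.mem_product]
        exact ⟨fun h => ⟨⟨h.1.1, h.2.1⟩, h.1.2.1, h.2.2⟩, fun h => ⟨⟨h.1.1, h.2.1,
          (s x).2.2.2.mono h.1.2 h.2.2⟩, h.1.2, h.2.2⟩⟩
      rw [e, Finset.sum_product, ← Finset.sum_mul_sum, sum_faceSign_below (s x).2.1,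
        sum_faceSign_below (s x).2.2.1, one_mul])
  refine ⟨f, e.trans ?_⟩
  exact (Finset.sum_subtype _ (by simp [mem_faces, Q, and_assoc])
    fun p : Finset V × Finset V => faceSign p.1 * faceSign p.2).symm

-- The indicator of disjointness is 1 minus the signed sum over faces `C` of the intersection, which
-- is 1 as soon as the intersection is nonempty. Exchanging sums turns the pairs above `C` into a
-- square.
open Classical in
lemma sum_disjoint_faces :
    ∑ p ∈ faces G ×ˢ faces G with Disjoint p.1 p.2, faceSign p.1 * faceSign p.2 =
      (∑ A ∈ faces G, faceSign A) ^ 2 -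
        ∑ C ∈ faces G, faceSign C * (∑ A ∈ faces G with C ⊆ A, faceSign A) ^ 2 := by
  have h1 : ∀ p ∈ faces G ×ˢ faces G, (if Disjoint p.1 p.2 then (1 : ℤ) else 0) =
      1 - ∑ C ∈ faces G, if C ⊆ p.1 ∧ C ⊆ p.2 then faceSign C else 0 := fun p hp => by
    rw [Finset.mem_product, mem_faces, mem_faces] at hp
    rw [← Finset.sum_filter]
    split_ifs with hd
    · rw [Finset.filter_eq_empty_iff.2, Finset.sum_empty, sub_zero]
      intro C hC ⟨h, h'⟩
      obtain ⟨v, hv⟩ := ((mem_faces G).1 hC).1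
      exact Finset.disjoint_left.1 hd (h hv) (h' hv)
    · have hne : (p.1 ∩ p.2).Nonempty :=
        Finset.nonempty_iff_ne_empty.2 fun h => hd (Finset.disjoint_iff_inter_eq_empty.2 h)
      rw [← sum_faceSign_below (hp.1.mono hne Finset.inter_subset_left), faces,
        Finset.filter_filter]
      simp only [Finset.subset_inter_iff, sub_self]
  have h2 : ∀ C, (∑ A ∈ faces G with C ⊆ A, faceSign A) ^ 2 =
      ∑ p ∈ faces G ×ˢ faces G,
        if C ⊆ p.1 ∧ C ⊆ p.2 then faceSign p.1 * faceSign p.2 else 0 := fun C => by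
    rw [sq, Finset.sum_mul_sum, ← Finset.sum_product', ← Finset.sum_filter]
    refine Finset.sum_congr ?_ fun _ _ => rfl
    ext p
    simp only [Finset.mem_product, Finset.mem_filter]
    tauto
  simp only [h2, Finset.mul_sum]
  rw [Finset.sum_comm, sq, Finset.sum_mul_sum, ← Finset.sum_product', ← Finset.sum_sub_distrib,
    Finset.sum_filter]
  refine Finset.sum_congr rfl fun p hp => ?_
  rw [← mul_one (faceSign p.1 * faceSign p.2), ← mul_zero (faceSign p.1 * faceSign p.2),
    ← mul_ite, h1 p hp, mul_sub, Finset.mul_sum]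
  congr 1
  refine Finset.sum_congr rfl fun C _ => ?_
  split_ifs <;> ring

open Classical in
lemma faces_eq [Fintype G.edgeSet] : faces G = 
    Finset.univ.image (fun v : V => {v}) ∪ G.edgeFinset.image Sym2.toFinset := by
  ext A
  rw [mem_faces, Finset.mem_union, Finset.mem_image, Finset.mem_image]
  constructor
  · rintro ⟨⟨u, hu⟩, ⟨v, hv⟩ | ⟨a, b, hab, hA⟩⟩
    · refine Or.inl ⟨v, Finset.mem_univ _, ?_⟩
      ext w
      rw [Finset.mem_singleton]
      exact ⟨fun h => by rw [h, ← hv u hu]; exact hu, hv w⟩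
    -- A nonempty subset of the ends of an edge is the whole edge or one of its ends.
    · by_cases ha : a ∈ A
      · by_cases hb : b ∈ A
        · refine Or.inr ⟨s(a, b), by simpa using hab, ?_⟩
          ext w
          simp only [Sym2.mem_toFinset, Sym2.mem_iff]
          exact ⟨by rintro (rfl | rfl) <;> assumption, hA w⟩
        · refine Or.inl ⟨a, Finset.mem_univ _, ?_⟩
          ext w
          rw [Finset.mem_singleton]
          exact ⟨fun h => h ▸ ha, fun h => (hA w h).resolve_right fun e => hb (e ▸ h)⟩
      · refine Or.inl ⟨b, Finset.mem_univ _, ?_⟩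
        have hb : b ∈ A := by
          rcases hA u hu with rfl | rfl
          · exact absurd hu ha
          · exact hu
        ext w
        rw [Finset.mem_singleton]
        exact ⟨fun h => h ▸ hb, fun h => (hA w h).resolve_left fun e => ha (e ▸ h)⟩
  · rintro (⟨v, -, rfl⟩ | ⟨e, he, rfl⟩)
    · exact ⟨⟨v, Finset.mem_singleton_self v⟩, Or.inl ⟨v, fun w => Finset.mem_singleton.1⟩⟩
    · induction e with
      | _ a b =>
        refine ⟨⟨a, by simp⟩, Or.inr ⟨a, b, by simpa using he, fun w hw => by simpa using hw⟩⟩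

omit [Fintype V] in
lemma card_toFinset_edge [DecidableEq V] {e : Sym2 V} (he : e ∈ G.edgeSet) :
    e.toFinset.card = 2 :=
  Sym2.card_toFinset_of_not_isDiag e (G.not_isDiag_of_mem_edgeSet he)

open Classical in
lemma sum_faces [Fintype G.edgeSet] (f : Finset V → ℤ) :
    ∑ A ∈ faces G, f A = ∑ v, f {v} + ∑ e ∈ G.edgeFinset, f e.toFinset := by
  rw [faces_eq, Finset.sum_union, Finset.sum_image, Finset.sum_image]
  · intro e _ e' _ h
    ext v
    rw [← Sym2.mem_toFinset, ← Sym2.mem_toFinset, h]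
  · exact fun v _ w _ h => Finset.singleton_injective h
  · rw [Finset.disjoint_left]
    intro A hA hA'
    obtain ⟨v, -, rfl⟩ := Finset.mem_image.1 hA
    obtain ⟨e, he, h⟩ := Finset.mem_image.1 hA'
    have := card_toFinset_edge G (SimpleGraph.mem_edgeFinset.1 he)
    rw [h, Finset.card_singleton] at this
    omega

open Classical in
lemma sum_faces_above [Fintype G.edgeSet] (C : Finset V) : ∑ A ∈ faces G with C ⊆ A, faceSign A =
    (Finset.univ.filter fun v : V => C ⊆ {v}).card -
      (G.edgeFinset.filter fun e => C ⊆ e.toFinset).card := by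
  rw [Finset.sum_filter, sum_faces]
  have : ∀ e ∈ G.edgeFinset, (if C ⊆ e.toFinset then faceSign e.toFinset else 0) =
      -(if C ⊆ e.toFinset then (1 : ℤ) else 0) := fun e he => by
    have := card_toFinset_edge G (SimpleGraph.mem_edgeFinset.1 he)
    simp [faceSign, this]
    split_ifs <;> norm_num
  rw [Finset.sum_congr rfl this, Finset.sum_neg_distrib, Finset.sum_boole]
  simp [faceSign, Finset.sum_boole, sub_eq_add_neg]

open Classical in
lemma sum_faceSign [Fintype G.edgeSet] :
    ∑ A ∈ faces G, faceSign A = (Fintype.card V : ℤ) - G.edgeFinset.card := by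
  have := sum_faces_above G ∅
  simpa using this

open Classical in
lemma sum_faces_above_singleton [DecidableRel G.Adj] (v : V) :
    ∑ A ∈ faces G with {v} ⊆ A, faceSign A = 1 - (G.degree v : ℤ) := by
  rw [sum_faces_above]
  congr 2
  · simp [Finset.filter_eq]
  · rw [← G.card_incidenceFinset_eq_degree]
    congr 1
    ext e
    simp [SimpleGraph.mem_incidenceFinset, SimpleGraph.incidenceSet]

open Classical in
lemma sum_faces_above_edge [Fintype G.edgeSet] {e : Sym2 V} (he : e ∈ G.edgeFinset) :
    ∑ A ∈ faces G with e.toFinset ⊆ A, faceSign A = -1 := by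
  have h2 := fun {e} he => card_toFinset_edge G (e := e) (SimpleGraph.mem_edgeFinset.1 he)
  rw [sum_faces_above]
  have h : (Finset.univ.filter fun v : V => e.toFinset ⊆ {v}) = ∅ :=
    Finset.filter_eq_empty_iff.2 fun v _ h => by
      have := Finset.card_le_card h
      rw [h2 he, Finset.card_singleton] at this
      omega
  have h' : (G.edgeFinset.filter fun e' => e.toFinset ⊆ e'.toFinset) = {e} := by
    ext e'
    rw [Finset.mem_filter, Finset.mem_singleton]
    constructor
    · rintro ⟨he', h⟩
      have := Finset.eq_of_subset_of_card_le h (by rw [h2 he, h2 he'])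
      ext v
      rw [← Sym2.mem_toFinset, ← Sym2.mem_toFinset, this]
    · rintro rfl
      exact ⟨he, subset_rfl⟩
  rw [h, h']
  simp

end Counting

end GraphConfig

/-- The Euler characteristic of the configuration space of two distinct points on a finite graph. -/
theorem corollary2p2 {V : Type u} [Fintype V] (G : SimpleGraph V) [DecidableRel G.Adj] :
    GraphConfig.HasFiniteHomology (GraphConfig.realization G) ∧
    GraphConfig.HasFiniteHomology (GraphConfig.ConfigTwo (GraphConfig.realization G)) ∧
    GraphConfig.eulerChar (GraphConfig.ConfigTwo (GraphConfig.realization G)) =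
      GraphConfig.eulerChar (GraphConfig.realization G) ^ 2 +
        GraphConfig.eulerChar (GraphConfig.realization G) -
        ∑ v : V, ((G.degree v : ℤ) - 1) * ((G.degree v : ℤ) - 2) := by
  classical
  obtain ⟨f₁, e₁⟩ := GraphConfig.eulerChar_realization G
  obtain ⟨f₂, e₂⟩ := GraphConfig.eulerChar_configTwo G
  refine ⟨f₁, f₂, ?_⟩
  have hs : ∑ C ∈ GraphConfig.faces G, GraphConfig.faceSign C *
      (∑ A ∈ GraphConfig.faces G with C ⊆ A, GraphConfig.faceSign A) ^ 2 =
      ∑ v, (1 - (G.degree v : ℤ)) ^ 2 - G.edgeFinset.card := by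
    -- A vertex contributes `(1 - μ) ^ 2`; an edge contributes its sign `-1` times `(-1) ^ 2`.
    rw [GraphConfig.sum_faces, sub_eq_add_neg]
    congr 1
    · refine Finset.sum_congr rfl fun v _ => ?_
      rw [GraphConfig.sum_faces_above_singleton]
      simp [GraphConfig.faceSign]
    · rw [Finset.card_eq_sum_ones, Nat.cast_sum, ← Finset.sum_neg_distrib]
      refine Finset.sum_congr rfl fun e he => ?_
      rw [GraphConfig.sum_faces_above_edge G he, GraphConfig.faceSign,
        GraphConfig.card_toFinset_edge G (SimpleGraph.mem_edgeFinset.1 he)]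
      norm_num
  have hdeg : ∑ v, (G.degree v : ℤ) = 2 * G.edgeFinset.card := by
    exact_mod_cast G.sum_degrees_eq_twice_card_edges
  -- Summed form of `(μ - 1)(μ - 2) = (1 - μ) ^ 2 - μ + 1`; by the handshake lemma the linear term
  -- becomes twice the number of edges.
  have hexp : ∑ v, ((G.degree v : ℤ) - 1) * ((G.degree v : ℤ) - 2) =
      ∑ v, (1 - (G.degree v : ℤ)) ^ 2 - ∑ v, (G.degree v : ℤ) + Fintype.card V := by
    rw [← Finset.sum_sub_distrib, Fintype.card_eq_sum_ones, Nat.cast_sum, ← Finset.sum_add_distrib]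
    exact Finset.sum_congr rfl fun v _ => by push_cast; ring
  have hχ : GraphConfig.eulerChar (GraphConfig.realization G) =
      (Fintype.card V : ℤ) - G.edgeFinset.card := by
    rw [e₁, GraphConfig.sum_faceSign]
  rw [hexp, hdeg, e₂, GraphConfig.sum_disjoint_faces, ← e₁, hs]
  linarith
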